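/- Let $V$ be a finite-dimensional complex vector space and $G\subseteq GL(V)$ a finite group. A bireflection is an element $s\in G$, $s\neq \mathrm{id}$, with $\operatorname{rank}(\mathrm{id}-s)=2$; put $V^s=\ker(\mathrm{id}-s)$. Let $\mathcal S'$ be the set of bireflections $s\in G$ such that $\det(g|_{V/V^s})=1$ for every $g$ in the centraliser $Z_G(s)$, and let $S$ be the subgroup of $G$ generated by $\mathcal S'$. For each $s\in\mathcal S'$ let $\Omega_s$ be a skew-symmetric bilinear form on $V$ with radical $V^s$ (it is unique up to a nonzero scalar), these forms being chosen so that $\Omega_{g^{-1}sg}(v,w)=\Omega_s(g(v),g(w))$ for all $g\in G$ and $v,w\in V$. Let $b_1,\dots,b_N$ be a basis of the space $((\bigwedge^2V)^*)^G$ of $G$-invariant skew-symmetric bilinear forms on $V$. For $\mathbf t=(t_1,\dots,t_N)\in\mathbb C^N$ and a function $\mathbf c:\mathcal S'\to\mathbb C$, $s\mapsto c_s$, that is invariant under conjugation by $G$, put $$\kappa(v,w)=\sum_{i=1}^N t_i\,b_i(v,w)\,\mathrm{id}+\sum_{s\in\mathcal S'}c_s\,\Omega_s(v,w)\,s\in\mathbb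 CG\qquad(v,w\in V),$$ and let the graded Hecke algebra with parameters $\mathbf t,\mathbf c$ be $$A_{\mathbf t,\mathbf c}=(T(V)\ast G)/\langle\, vw-wv-\kappa(v,w)\;:\;v,w\in V\,\rangle,$$ where $T(V)\ast G$ is the skew group algebra of $G$ over the tensor algebra of $V$. Let $e\in A_{\mathbf t,\mathbf c}$ be the image of $\frac1{|G|}\sum_{g\in G}g$. Multiplication makes $A_{\mathbf t,\mathbf c}e$ a left $A_{\mathbf t,\mathbf c}$-module and a right module over the algebra $eA_{\mathbf t,\mathbf c}e$ (whose unit is $e$). Assume that $G=S$. Then left multiplication $$\eta:A_{\mathbf t,\mathbf c}\to\operatorname{End}_{eA_{\mathbf t,\mathbf c}e}(A_{\mathbf t,\mathbf c}e),\qquad \eta(a)(x)=ax,$$ is an isomorphism of $\mathbb C$-algebras onto the algebra of endomorphisms of the right $eA_{\mathbf t,\mathbf c}e$-module $A_{\mathbf t,\mathbf c}e$. -/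

import Mathlib

noncomputable section

namespace GradedHecke

section SkewGroupAlgebra

variable {V : Type*} [AddCommGroup V] [Module ℂ V]

/-- The extension of a linear automorphism of `V` to an algebra endomorphism of `T(V)`. -/
def tensorMap (g : V ≃ₗ[ℂ] V) : TensorAlgebra ℂ V →ₐ[ℂ] TensorAlgebra ℂ V :=
  TensorAlgebra.lift ℂ (TensorAlgebra.ι ℂ ∘ₗ g.toLinearMap)

@[simp]
theorem tensorMap_ι (g : V ≃ₗ[ℂ] V) (v : V) :
    tensorMap g (TensorAlgebra.ι ℂ v) = TensorAlgebra.ι ℂ (g v) := by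
  simp [tensorMap]

theorem tensorMap_one : tensorMap (1 : V ≃ₗ[ℂ] V) = AlgHom.id ℂ (TensorAlgebra ℂ V) := by
  apply TensorAlgebra.hom_ext
  ext v
  simp

theorem tensorMap_mul (g h : V ≃ₗ[ℂ] V) :
    tensorMap (g * h) = (tensorMap g).comp (tensorMap h) := by
  apply TensorAlgebra.hom_ext
  ext v
  simp

/-- The action of `G ⊆ GL(V)` on `T(V)` by algebra automorphisms extending its action on `V`. -/
instance tensorAction (G : Subgroup (V ≃ₗ[ℂ] V)) : MulSemiringAction G (TensorAlgebra ℂ V) where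
  smul g x := tensorMap (g : V ≃ₗ[ℂ] V) x
  one_smul x := DFunLike.congr_fun tensorMap_one x
  mul_smul g h x := DFunLike.congr_fun (tensorMap_mul (g : V ≃ₗ[ℂ] V) h) x
  smul_zero g := map_zero (tensorMap (g : V ≃ₗ[ℂ] V))
  smul_add g := map_add (tensorMap (g : V ≃ₗ[ℂ] V))
  smul_one g := map_one (tensorMap (g : V ≃ₗ[ℂ] V))
  smul_mul g := map_mul (tensorMap (g : V ≃ₗ[ℂ] V))

theorem smul_def (G : Subgroup (V ≃ₗ[ℂ] V)) (g : G) (x : TensorAlgebra ℂ V) :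
    g • x = tensorMap (g : V ≃ₗ[ℂ] V) x := rfl

instance tensorAction_comm (G : Subgroup (V ≃ₗ[ℂ] V)) :
    SMulCommClass G ℂ (TensorAlgebra ℂ V) where
  smul_comm g a x := map_smul (tensorMap (g : V ≃ₗ[ℂ] V)) a x

/-- The skew group algebra `T(V) ∗ G`, with multiplication `(x g)(y h) = x g(y) gh`. -/
abbrev SkewTensor (G : Subgroup (V ≃ₗ[ℂ] V)) : Type _ :=
  SkewMonoidAlgebra (TensorAlgebra ℂ V) G

/-- The inclusion of `V` in `T(V) ∗ G`. -/
def vec (G : Subgroup (V ≃ₗ[ℂ] V)) (v : V) : SkewTensor G :=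
  SkewMonoidAlgebra.single 1 (TensorAlgebra.ι ℂ v)

/-- The inclusion of the group algebra `ℂG` in `T(V) ∗ G`. -/
def groupAlgebraIncl (G : Subgroup (V ≃ₗ[ℂ] V)) : MonoidAlgebra ℂ G →ₐ[ℂ] SkewTensor G :=
  MonoidAlgebra.lift ℂ (SkewTensor G) G (SkewMonoidAlgebra.of (TensorAlgebra ℂ V) G)

/-- The relations `[v, w] = κ(v, w)` for `v, w ∈ V`. -/
inductive Rel (G : Subgroup (V ≃ₗ[ℂ] V)) (κ : V → V → MonoidAlgebra ℂ G) :
    SkewTensor G → SkewTensor G → Prop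
  | comm (v w : V) :
      Rel G κ (vec G v * vec G w - vec G w * vec G v) (groupAlgebraIncl G (κ v w))

/-- The factor algebra `(T(V) ∗ G) / ⟨[v, w] - κ(v, w) : v, w ∈ V⟩`. -/
def Quot (G : Subgroup (V ≃ₗ[ℂ] V)) (κ : V → V → MonoidAlgebra ℂ G) : Type _ :=
  RingQuot (Rel G κ)

instance (G : Subgroup (V ≃ₗ[ℂ] V)) (κ : V → V → MonoidAlgebra ℂ G) : Ring (Quot G κ) :=
  inferInstanceAs (Ring (RingQuot (Rel G κ)))

instance (G : Subgroup (V ≃ₗ[ℂ] V)) (κ : V → V → MonoidAlgebra ℂ G) : Algebra ℂ (Quot G κ) :=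
  inferInstanceAs (Algebra ℂ (RingQuot (Rel G κ)))

/-- The projection of `T(V) ∗ G` onto the factor algebra. -/
def quotMk (G : Subgroup (V ≃ₗ[ℂ] V)) (κ : V → V → MonoidAlgebra ℂ G) :
    SkewTensor G →ₐ[ℂ] Quot G κ :=
  RingQuot.mkAlgHom ℂ (Rel G κ)

end SkewGroupAlgebra

section Parameters

variable {V : Type*} [AddCommGroup V] [Module ℂ V]

/-- `V^s = ker (id - s)`. -/
def fixedSpace (s : V ≃ₗ[ℂ] V) : Submodule ℂ V :=
  LinearMap.ker (LinearMap.id - s.toLinearMap)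

theorem mem_fixedSpace {s : V ≃ₗ[ℂ] V} {v : V} : v ∈ fixedSpace s ↔ s v = v := by
  rw [fixedSpace, LinearMap.mem_ker, LinearMap.sub_apply, sub_eq_zero, eq_comm]
  rfl

theorem fixedSpace_le_comap {g s : V ≃ₗ[ℂ] V} (h : Commute g s) :
    fixedSpace s ≤ (fixedSpace s).comap g.toLinearMap := by
  intro v hv
  rw [mem_fixedSpace] at hv
  rw [Submodule.mem_comap, LinearEquiv.coe_coe, mem_fixedSpace]
  have h1 : s (g v) = g (s v) := (DFunLike.congr_fun h.eq v).symm
  rw [h1, hv]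

/-- For `g` commuting with `s`, the determinant of the map that `g` induces on `V / V^s`. -/
def quotDet {g s : V ≃ₗ[ℂ] V} (h : Commute g s) : ℂ :=
  LinearMap.det ((fixedSpace s).mapQ (fixedSpace s) g.toLinearMap (fixedSpace_le_comap h))

/-- A bireflection: a non-identity element with `rank (id - s) = 2`. -/
def IsBireflection (s : V ≃ₗ[ℂ] V) : Prop :=
  s ≠ 1 ∧ Module.finrank ℂ (LinearMap.range (LinearMap.id - s.toLinearMap)) = 2

/-- The set `𝒮'` of those bireflections `s` in `G` for which every element of the centraliser
`Z_G(s)` acts on `V / V^s` with determinant one. -/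
def bireflections (G : Subgroup (V ≃ₗ[ℂ] V)) : Set G :=
  {s | IsBireflection (s : V ≃ₗ[ℂ] V) ∧
    ∀ (g : G) (h : Commute (g : V ≃ₗ[ℂ] V) (s : V ≃ₗ[ℂ] V)), quotDet h = 1}

/-- The space `((⋀² V)*)^G` of `G`-invariant skew-symmetric bilinear forms on `V`. -/
def invariantForms (G : Subgroup (V ≃ₗ[ℂ] V)) : Submodule ℂ (LinearMap.BilinForm ℂ V) where
  carrier := {B | B.IsAlt ∧
    ∀ (g : G) (v w : V), B ((g : V ≃ₗ[ℂ] V) v) ((g : V ≃ₗ[ℂ] V) w) = B v w}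
  zero_mem' := ⟨fun _ => rfl, fun _ _ _ => rfl⟩
  add_mem' := by
    rintro B C ⟨hB, hB'⟩ ⟨hC, hC'⟩
    refine ⟨fun v => ?_, fun g v w => ?_⟩
    · have h1 := hB v
      have h2 := hC v
      simp [h1, h2]
    · simp [hB', hC']
  smul_mem' := by
    rintro a B ⟨hB, hB'⟩
    refine ⟨fun v => ?_, fun g v w => ?_⟩
    · have h1 := hB v
      simp [h1]
    · simp [hB']

/-- An admissible choice of the forms `Ω_s`, `s ∈ 𝒮'`. Each `Ω_s` is skew-symmetric with radical
`V^s`; this determines it up to a nonzero scalar, and the scalars are compatible along conjugacy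
classes: `Ω_{g⁻¹sg}(v, w) = Ω_s(g(v), g(w))`. -/
structure FormSystem (G : Subgroup (V ≃ₗ[ℂ] V)) where
  /-- The form `Ω_s`. -/
  form : bireflections G → LinearMap.BilinForm ℂ V
  isAlt : ∀ s, (form s).IsAlt
  radical : ∀ s, LinearMap.ker (form s) = fixedSpace ((s : G) : V ≃ₗ[ℂ] V)
  conj : ∀ (s s' : bireflections G) (g : G), (s' : G) = g⁻¹ * s * g →
    ∀ v w : V, form s' v w = form s ((g : V ≃ₗ[ℂ] V) v) ((g : V ≃ₗ[ℂ] V) w)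

open scoped Classical in
/-- `κ(v, w) = (∑ i, t_i b_i(v, w)) id + ∑_{s ∈ 𝒮'} c_s Ω_s(v, w) s`. -/
def kappa {G : Subgroup (V ≃ₗ[ℂ] V)} [Fintype G] {N : ℕ}
    (b : Module.Basis (Fin N) ℂ (invariantForms G)) (F : FormSystem G)
    (t : Fin N → ℂ) (c : bireflections G → ℂ) (v w : V) : MonoidAlgebra ℂ G :=
  MonoidAlgebra.single 1 (∑ i, t i * (b i : LinearMap.BilinForm ℂ V) v w) +
    ∑ s : bireflections G, MonoidAlgebra.single (s : G) (c s * F.form s v w)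

/-- The algebra `A_{t,c}`. -/
abbrev Alg {G : Subgroup (V ≃ₗ[ℂ] V)} [Fintype G] {N : ℕ}
    (b : Module.Basis (Fin N) ℂ (invariantForms G)) (F : FormSystem G)
    (t : Fin N → ℂ) (c : bireflections G → ℂ) : Type _ :=
  Quot G (kappa b F t c)

end Parameters

section Idempotent

variable {V : Type*} [AddCommGroup V] [Module ℂ V]

/-- The symmetrizing idempotent `|G|⁻¹ ∑ g` of `ℂG`. -/
def groupIdem (G : Subgroup (V ≃ₗ[ℂ] V)) [Fintype G] : MonoidAlgebra ℂ G :=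
  (Fintype.card G : ℂ)⁻¹ • ∑ g : G, MonoidAlgebra.of ℂ G g

theorem of_mul_groupIdem (G : Subgroup (V ≃ₗ[ℂ] V)) [Fintype G] (h : G) :
    MonoidAlgebra.of ℂ G h * groupIdem G = groupIdem G := by
  rw [groupIdem, mul_smul_comm, Finset.mul_sum]
  congr 1
  simp_rw [← map_mul]
  exact Fintype.sum_equiv (Equiv.mulLeft h) _ _ fun _ => rfl

theorem groupIdem_idem (G : Subgroup (V ≃ₗ[ℂ] V)) [Fintype G] :
    IsIdempotentElem (groupIdem G) := by
  have h : (∑ g : G, MonoidAlgebra.of ℂ G g) * groupIdem G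
      = (Fintype.card G : ℂ) • groupIdem G := by
    rw [Finset.sum_mul]
    simp_rw [of_mul_groupIdem]
    simp [Finset.card_univ, Nat.cast_smul_eq_nsmul]
  have hc : (Fintype.card G : ℂ) ≠ 0 := Nat.cast_ne_zero.2 Fintype.card_ne_zero
  change ((Fintype.card G : ℂ)⁻¹ • ∑ g : G, MonoidAlgebra.of ℂ G g) * groupIdem G = groupIdem G
  rw [smul_mul_assoc, h, smul_smul, inv_mul_cancel₀ hc, one_smul]

/-- The image `e` of the symmetrizing idempotent in `(T(V) ∗ G) / ⟨[v, w] - κ(v, w)⟩`. -/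
def idem (G : Subgroup (V ≃ₗ[ℂ] V)) [Fintype G] (κ : V → V → MonoidAlgebra ℂ G) : Quot G κ :=
  quotMk G κ (groupAlgebraIncl G (groupIdem G))

theorem idem_isIdempotentElem (G : Subgroup (V ≃ₗ[ℂ] V)) [Fintype G]
    (κ : V → V → MonoidAlgebra ℂ G) : IsIdempotentElem (idem G κ) :=
  ((groupIdem_idem G).map (groupAlgebraIncl G)).map (quotMk G κ)

end Idempotent

section Corner

variable {A : Type*} [Ring A]

/-- The left ideal `Ae = {ae : a ∈ A}`. -/
def leftIdeal (e : A) : Submodule A A := LinearMap.range (LinearMap.toSpanSingleton A A e)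

theorem mem_leftIdeal {e x : A} : x ∈ leftIdeal e ↔ ∃ a, a * e = x := by
  simp [leftIdeal]

variable {e : A} {he : IsIdempotentElem e}

theorem mul_mem_leftIdeal (x : leftIdeal e) (y : he.Corner) : (x : A) * y.1 ∈ leftIdeal e := by
  obtain ⟨r, hr⟩ := y.2
  exact mem_leftIdeal.2 ⟨x * (e * r), by rw [← hr]; simp only [mul_assoc]⟩

/-- `Ae` is a right `eAe`-module by multiplication in `A`; here `he.Corner` is `eAe`. -/
instance cornerModule : Module he.Cornerᵐᵒᵖ (leftIdeal e) where
  smul y x := ⟨(x : A) * y.unop.1, mul_mem_leftIdeal x y.unop⟩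
  one_smul x := by
    obtain ⟨a, ha⟩ := mem_leftIdeal.1 x.2
    apply Subtype.ext
    change (x : A) * e = x
    rw [← ha, mul_assoc, he.eq]
  mul_smul y z x := Subtype.ext (mul_assoc (x : A) z.unop.1 y.unop.1).symm
  smul_zero y := Subtype.ext (zero_mul y.unop.1)
  smul_add y x x' := Subtype.ext (add_mul (x : A) x' y.unop.1)
  add_smul y z x := Subtype.ext (mul_add (x : A) y.unop.1 z.unop.1)
  zero_smul x := Subtype.ext (mul_zero (x : A))

theorem corner_smul_coe (y : he.Corner) (x : leftIdeal e) :
    ((MulOpposite.op y • x : leftIdeal e) : A) = (x : A) * y.1 := rfl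

instance cornerModule_comm {R : Type*} [CommRing R] [Algebra R A] :
    SMulCommClass he.Cornerᵐᵒᵖ R (leftIdeal e) where
  smul_comm y r x := Subtype.ext (smul_mul_assoc r (x : A) y.unop.1)

instance cornerModule_comm' {R : Type*} [CommRing R] [Algebra R A] :
    SMulCommClass R he.Cornerᵐᵒᵖ (leftIdeal e) :=
  SMulCommClass.symm _ _ _

/-- Scalars act on `eAe` as on `A`. -/
instance cornerSMul {R : Type*} [CommRing R] [Algebra R A] : SMul R he.Corner where
  smul r y := ⟨r • y.1, by
    obtain ⟨a, ha⟩ := y.2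
    exact ⟨r • a, by rw [← ha]; simp only [mul_smul_comm, smul_mul_assoc]⟩⟩

instance cornerTower {R : Type*} [CommRing R] [Algebra R A] :
    IsScalarTower R he.Cornerᵐᵒᵖ (leftIdeal e) where
  smul_assoc r y x := Subtype.ext (mul_smul_comm r (x : A) y.unop.1)

end Corner

end GradedHecke

end

/-!
The algebra `A = A_{t,c}` acts on the polynomial algebra `S = S(V)`, written as `ℂ[X_i]` by means of
a basis of `V`, and `S ≅ Ae` as an `A`-module. Everything is deduced from this representation.

*The representation.* The group acts on `S` by substitutions and `v ∈ V` by an operator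
`X_v = v + Y_v`, where `Y_v` lowers degrees and is defined by the recursion
`(n + 1) Y_v f = ∑ (X_{x_i} Y_v + κ(v, x_i)) ∂_i f` for `f` homogeneous of degree `n`. This is the
formula forced by requiring `w ^ n ∈ S` to correspond to `w ^ n e ∈ Ae`. The relation
`[X_v, X_w] = κ(v, w)` is proved by induction on the degree of the argument (`defect_eq_zero`): the
recursion gives the part of it in which one of the two vectors is contracted with the argument, and
the Jacobi identity for `κ` gives the rest. The Jacobi identity (`FormSystem.jacobi`) holds because
an alternating trilinear map on the two-dimensional space `V / V^s` vanishes.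

*The filtration.* Filter `A` by the number of factors from `V`. Modulo lower terms, an element of
`A` is a symmetrized combination `∑ F_g g` with `F_g ∈ S` homogeneous, and it acts on `S` by
`f ↦ ∑ F_g g(f)` modulo lower terms. By Dedekind's independence of characters `A` acts faithfully
on `S` (`PolynomialRep.eq_zero_of_act_eq_zero`), and `Ae` is the image of `S` under symmetrization
(`PolynomialRep.mul_groupIdem_eq`).

*Surjectivity.* An endomorphism of the `eAe`-module `Ae` becomes an endomorphism `φ` of `S`. It
raises degrees by a bounded amount, as `S` is finite over `S^G`, and its leading symbol is
`S^G`-linear. If `G` contains no reflections, an `S^G`-linear endomorphism of `S` has the form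
`∑ F_g g` with `F_g ∈ S` (`NoReflections.exists_eq_sum`). Over the fraction field this follows from
Lagrange interpolation; a prime `p` in the denominator can be cancelled because the elements of `G`
remain distinct modulo `p`, so that Dedekind's theorem applies over `S / p`. Subtracting an element
of `A` with the same symbol lowers the order of `φ`, and an endomorphism of negative order is zero.

Finally, the elements of `𝒮'` have determinant one on `V / V^s` and hence on `V`, so a group they
generate lies in `SL(V)` and contains no reflections (`noReflections`).
-/

set_option linter.unusedSectionVars false

noncomputable section

namespace GradedHecke

open MvPolynomial

/-! ### Polynomials graded by degree, and linear substitutions -/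

section Degree

variable {ι : Type*}

/-- The space of polynomials all of whose monomials have degree `< m`. The bound is an integer, so
that degrees can be lowered freely; the space is zero for `m ≤ 0`. -/
def degLT (ι : Type*) (m : ℤ) : Submodule ℂ (MvPolynomial ι ℂ) where
  carrier := {f | ∀ a, coeff a f ≠ 0 → (a.degree : ℤ) < m}
  zero_mem' := fun a ha => absurd (coeff_zero a) ha
  add_mem' := by
    intro f g hf hg a ha
    by_cases h : coeff a f = 0
    · exact hg a fun h' => ha (by rw [coeff_add, h, h', add_zero])
    · exact hf a h
  smul_mem' := by
    intro r f hf a ha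
    exact hf a fun h => ha (by rw [coeff_smul, h, smul_zero])

theorem mem_degLT {m : ℤ} {f : MvPolynomial ι ℂ} :
    f ∈ degLT ι m ↔ ∀ a, coeff a f ≠ 0 → (a.degree : ℤ) < m := Iff.rfl

theorem degLT_mono {m m' : ℤ} (h : m ≤ m') : degLT ι m ≤ degLT ι m' :=
  fun _ hf a ha => (hf a ha).trans_le h

theorem eq_zero_of_mem_degLT {m : ℤ} (hm : m ≤ 0) {f : MvPolynomial ι ℂ} (hf : f ∈ degLT ι m) :
    f = 0 := by
  ext a
  by_contra h
  have := hf a h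
  omega

theorem isHomogeneous_iff_degree {f : MvPolynomial ι ℂ} {n : ℕ} :
    f.IsHomogeneous n ↔ ∀ a, coeff a f ≠ 0 → a.degree = n := by
  constructor
  · intro h a ha
    by_contra hne
    exact ha (h.coeff_eq_zero hne)
  · intro h a ha
    have := h a ha
    rwa [Finsupp.degree_eq_weight_one] at this

theorem IsHomogeneous.mem_degLT {f : MvPolynomial ι ℂ} {n : ℕ} (hf : f.IsHomogeneous n)
    {m : ℤ} (h : (n : ℤ) < m) : f ∈ degLT ι m := by
  intro a ha
  rw [isHomogeneous_iff_degree.1 hf a ha]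
  exact h

theorem exists_mem_degLT (f : MvPolynomial ι ℂ) : f ∈ degLT ι (f.totalDegree + 1) := by
  intro a ha
  have h := le_totalDegree (mem_support_iff.2 ha)
  have : a.degree = a.sum fun _ e => e := rfl
  omega

theorem mul_mem_degLT {m n k : ℤ} {f g : MvPolynomial ι ℂ} (hf : f ∈ degLT ι m)
    (hg : g ∈ degLT ι n) (h : m + n ≤ k + 1) : f * g ∈ degLT ι k := by
  classical
  intro a ha
  rw [coeff_mul] at ha
  obtain ⟨⟨b, c⟩, hbc, hne⟩ := Finset.exists_ne_zero_of_sum_ne_zero ha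
  have hb := hf b (left_ne_zero_of_mul hne)
  have hc := hg c (right_ne_zero_of_mul hne)
  rw [Finset.HasAntidiagonal.mem_antidiagonal] at hbc
  have : a.degree = b.degree + c.degree := by rw [← hbc]; simp
  omega

/-- A homogeneous polynomial of degree `n` with all degrees below `n` vanishes. -/
theorem IsHomogeneous.eq_zero_of_mem_degLT {f : MvPolynomial ι ℂ} {n : ℕ}
    (hf : f.IsHomogeneous n) {m : ℤ} (h : f ∈ degLT ι m) (hm : m ≤ n) : f = 0 := by
  ext a
  by_contra ha
  have h1 := isHomogeneous_iff_degree.1 hf a ha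
  have h2 := h a ha
  omega

theorem homogeneousComponent_mem_degLT {f : MvPolynomial ι ℂ} {m : ℤ} (h : f ∈ degLT ι m)
    (n : ℕ) : homogeneousComponent n f ∈ degLT ι m := by
  intro a ha
  rw [coeff_homogeneousComponent] at ha
  exact h a fun h0 => ha (by simp [h0])

theorem homogeneousComponent_eq_zero_of_mem_degLT {f : MvPolynomial ι ℂ} {m : ℤ}
    (h : f ∈ degLT ι m) {n : ℕ} (hn : m ≤ n) : homogeneousComponent n f = 0 :=
  IsHomogeneous.eq_zero_of_mem_degLT (homogeneousComponent_isHomogeneous n f)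
    (homogeneousComponent_mem_degLT h n) hn

/-- A subspace containing the homogeneous polynomials of degree `< m` contains `degLT ι m`. -/
theorem degLT_le {m : ℤ} {W : Submodule ℂ (MvPolynomial ι ℂ)}
    (h : ∀ n : ℕ, (n : ℤ) < m → ∀ f : MvPolynomial ι ℂ, f.IsHomogeneous n → f ∈ W) :
    degLT ι m ≤ W := by
  intro f hf
  rw [← sum_homogeneousComponent f]
  refine Submodule.sum_mem _ fun n _ => ?_
  by_cases hn : (n : ℤ) < m
  · exact h n hn _ (homogeneousComponent_isHomogeneous n f)
  · rw [homogeneousComponent_eq_zero_of_mem_degLT hf (not_lt.1 hn)]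
    exact W.zero_mem

theorem mem_of_forall_isHomogeneous {W : Submodule ℂ (MvPolynomial ι ℂ)}
    (h : ∀ (n : ℕ) (f : MvPolynomial ι ℂ), f.IsHomogeneous n → f ∈ W) (f : MvPolynomial ι ℂ) :
    f ∈ W :=
  degLT_le (fun n _ => h n) (exists_mem_degLT f)

theorem linearMap_ext_isHomogeneous {W : Type*} [AddCommGroup W] [Module ℂ W]
    {P Q : MvPolynomial ι ℂ →ₗ[ℂ] W}
    (h : ∀ (n : ℕ) (f : MvPolynomial ι ℂ), f.IsHomogeneous n → P f = Q f) : P = Q := by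
  refine LinearMap.ext fun f => ?_
  exact mem_of_forall_isHomogeneous (W := LinearMap.eqLocus P Q) h f

theorem sub_homogeneousComponent_mem_degLT {f : MvPolynomial ι ℂ} {n : ℕ}
    (h : f ∈ degLT ι (n + 1)) : f - homogeneousComponent n f ∈ degLT ι n := by
  intro a ha
  rw [coeff_sub, coeff_homogeneousComponent] at ha
  split_ifs at ha with hn
  · simp at ha
  · have := h a (by simpa using ha)
    omega

theorem homogeneousComponent_mul_of_isHomogeneous (f : MvPolynomial ι ℂ) {h : MvPolynomial ι ℂ}
    {n : ℕ} (hh : h.IsHomogeneous n) (k : ℕ) : homogeneousComponent k (f * h) =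
      if n ≤ k then homogeneousComponent (k - n) f * h else 0 := by
  refine mem_of_forall_isHomogeneous
    (W := LinearMap.eqLocus (homogeneousComponent k ∘ₗ LinearMap.mulRight ℂ h)
      (if n ≤ k then LinearMap.mulRight ℂ h ∘ₗ homogeneousComponent (k - n) else 0))
    (fun j f hf => ?_) f |>.trans (by split_ifs <;> rfl)
  rw [LinearMap.mem_eqLocus, LinearMap.comp_apply, LinearMap.mulRight_apply,
    homogeneousComponent_of_mem (hf.mul hh)]
  split_ifs with h1 h2 h2
  · rw [LinearMap.comp_apply, homogeneousComponent_of_mem hf, if_pos (by omega)]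
    rfl
  · omega
  · rw [LinearMap.comp_apply, homogeneousComponent_of_mem hf, if_neg (by omega), map_zero]
  · rfl

theorem pderiv_mem_degLT (i : ι) {m : ℤ} {f : MvPolynomial ι ℂ} (hf : f ∈ degLT ι m) :
    pderiv i f ∈ degLT ι (m - 1) := by
  refine degLT_le (W := (degLT ι (m - 1)).comap (pderiv (R := ℂ) i).toLinearMap) ?_ hf
  intro n hn f hf
  obtain _ | n := n
  · have : pderiv i f = 0 := by
      rw [← totalDegree_zero_iff_isHomogeneous, totalDegree_eq_zero_iff_eq_C] at hf
      rw [hf, pderiv_C]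
    change pderiv i f ∈ degLT ι (m - 1)
    rw [this]
    exact Submodule.zero_mem _
  · exact IsHomogeneous.mem_degLT (hf.pderiv (i := i)) (by simp at hn ⊢; omega)

theorem isHomogeneous_of_succ_pderiv {f : MvPolynomial ι ℂ} {n : ℕ}
    (hf : f.IsHomogeneous (n + 1)) (i : ι) : (pderiv i f).IsHomogeneous n :=
  hf.pderiv

/-- A homogeneous polynomial of degree zero has zero derivatives. -/
theorem IsHomogeneous.pderiv_eq_zero {f : MvPolynomial ι ℂ} (hf : f.IsHomogeneous 0) (i : ι) :
    pderiv i f = 0 := by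
  rw [← totalDegree_zero_iff_isHomogeneous, totalDegree_eq_zero_iff_eq_C] at hf
  rw [hf, pderiv_C]

/-- The linear map on polynomials that is `T n` on homogeneous polynomials of degree `n`. -/
def gradedMap {W : Type*} [AddCommGroup W] [Module ℂ W] (T : ℕ → MvPolynomial ι ℂ →ₗ[ℂ] W) :
    MvPolynomial ι ℂ →ₗ[ℂ] W :=
  (basisMonomials ι ℂ).constr ℂ fun a => T a.degree (monomial a 1)

theorem gradedMap_of_isHomogeneous {W : Type*} [AddCommGroup W] [Module ℂ W]
    (T : ℕ → MvPolynomial ι ℂ →ₗ[ℂ] W) {f : MvPolynomial ι ℂ} {n : ℕ} (hf : f.IsHomogeneous n) :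
    gradedMap T f = T n f := by
  have h : ∀ (a : ι →₀ ℕ) (r : ℂ), gradedMap T (monomial a r) = T a.degree (monomial a r) := by
    intro a r
    have : monomial a r = r • basisMonomials ι ℂ a := by simp [smul_monomial]
    rw [this, map_smul, map_smul, gradedMap, Module.Basis.constr_basis, coe_basisMonomials]
  conv_lhs => rw [f.as_sum]
  conv_rhs => rw [f.as_sum]
  rw [map_sum, map_sum]
  refine Finset.sum_congr rfl fun a ha => ?_
  rw [h, isHomogeneous_iff_degree.1 hf a (mem_support_iff.1 ha)]

/-- The inverse of the operator `Euler + 1`: it divides degree `n` by `n + 1`. -/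
def eulerInv (ι : Type*) : MvPolynomial ι ℂ →ₗ[ℂ] MvPolynomial ι ℂ :=
  gradedMap fun n => ((n : ℂ) + 1)⁻¹ • LinearMap.id

theorem eulerInv_of_isHomogeneous {f : MvPolynomial ι ℂ} {n : ℕ} (hf : f.IsHomogeneous n) :
    eulerInv ι f = ((n : ℂ) + 1)⁻¹ • f :=
  gradedMap_of_isHomogeneous _ hf

theorem eulerInv_mem_degLT {m : ℤ} {f : MvPolynomial ι ℂ} (hf : f ∈ degLT ι m) :
    eulerInv ι f ∈ degLT ι m := by
  refine degLT_le (W := (degLT ι m).comap (eulerInv ι)) (fun n hn f hf => ?_) hf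
  rw [Submodule.mem_comap, eulerInv_of_isHomogeneous hf]
  exact Submodule.smul_mem _ _ (IsHomogeneous.mem_degLT hf hn)

end Degree

section LinearAction

variable {V : Type*} [AddCommGroup V] [Module ℂ V] {ι : Type*} [Fintype ι]
  (B : Module.Basis ι ℂ V)

/-- The identification of `V` with the linear forms of `ℂ[X_i]` given by a basis of `V`. -/
def linForm : V →ₗ[ℂ] MvPolynomial ι ℂ := B.constr ℂ X

theorem sum_repr_smul_apply {W : Type*} [AddCommGroup W] [Module ℂ W] (P : V →ₗ[ℂ] W) (v : V) :
    ∑ i, B.repr v i • P (B i) = P v := by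
  simp only [← map_smul, ← map_sum, B.sum_repr]

@[simp]
theorem linForm_basis (i : ι) : linForm B (B i) = X i := B.constr_basis ..

theorem linForm_apply (v : V) : linForm B v = ∑ i, B.repr v i • X i := B.constr_apply_fintype ..

theorem linForm_isHomogeneous (v : V) : (linForm B v).IsHomogeneous 1 := by
  rw [linForm_apply]
  refine IsHomogeneous.sum _ _ _ fun i _ => ?_
  rw [smul_eq_C_mul]
  exact (isHomogeneous_X ℂ i).C_mul _

theorem linForm_mem_degLT (v : V) : linForm B v ∈ degLT ι 2 :=
  IsHomogeneous.mem_degLT (linForm_isHomogeneous B v) (by norm_num)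

theorem pderiv_linForm (i : ι) (v : V) : pderiv i (linForm B v) = C (B.repr v i) := by
  classical
  rw [linForm_apply, map_sum, Finset.sum_eq_single i]
  · simp [smul_eq_C_mul]
  · intro j _ hj
    simp [pderiv_X, hj]
  · simp

theorem linForm_injective : Function.Injective (linForm B) := by
  rw [injective_iff_map_eq_zero]
  intro v hv
  apply B.repr.injective
  ext i
  have := pderiv_linForm B i v
  rw [hv, map_zero] at this
  simpa using this.symm

/-- The algebra endomorphism of `ℂ[X_i]` extending a linear automorphism of `V`. -/
def linSubst (g : V ≃ₗ[ℂ] V) : MvPolynomial ι ℂ →ₐ[ℂ] MvPolynomial ι ℂ :=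
  aeval fun i => linForm B (g (B i))

theorem linSubst_X (g : V ≃ₗ[ℂ] V) (i : ι) : linSubst B g (X i) = linForm B (g (B i)) :=
  aeval_X ..

theorem linSubst_linForm (g : V ≃ₗ[ℂ] V) (v : V) :
    linSubst B g (linForm B v) = linForm B (g v) := by
  rw [linForm_apply, map_sum]
  simp only [map_smul, linSubst_X]
  exact sum_repr_smul_apply B (linForm B ∘ₗ g.toLinearMap) v

/-- The action of `GL(V)` on the polynomial algebra by algebra endomorphisms. -/
def polyAct : (V ≃ₗ[ℂ] V) →* (MvPolynomial ι ℂ →ₐ[ℂ] MvPolynomial ι ℂ) where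
  toFun := linSubst B
  map_one' := by
    refine algHom_ext fun i => ?_
    rw [linSubst_X]
    exact linForm_basis B i
  map_mul' g h := by
    refine algHom_ext fun i => ?_
    rw [AlgHom.mul_apply, linSubst_X, linSubst_X, linSubst_linForm]
    rfl

theorem polyAct_X (g : V ≃ₗ[ℂ] V) (i : ι) : polyAct B g (X i) = linForm B (g (B i)) :=
  linSubst_X B g i

@[simp]
theorem polyAct_linForm (g : V ≃ₗ[ℂ] V) (v : V) :
    polyAct B g (linForm B v) = linForm B (g v) :=
  linSubst_linForm B g v

theorem polyAct_mul_apply (g h : V ≃ₗ[ℂ] V) (f : MvPolynomial ι ℂ) :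
    polyAct B (g * h) f = polyAct B g (polyAct B h f) := by
  rw [map_mul]
  rfl

theorem polyAct_one_apply (f : MvPolynomial ι ℂ) : polyAct B 1 f = f := by
  rw [map_one]
  rfl

theorem polyAct_injective (g : V ≃ₗ[ℂ] V) : Function.Injective (polyAct B g) := by
  intro f f' h
  have := congrArg (polyAct B g⁻¹) h
  simpa only [← polyAct_mul_apply, inv_mul_cancel, polyAct_one_apply] using this

theorem polyAct_isHomogeneous (g : V ≃ₗ[ℂ] V) {f : MvPolynomial ι ℂ} {n : ℕ}
    (hf : f.IsHomogeneous n) : (polyAct B g f).IsHomogeneous n := by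
  have := hf.aeval (fun i => linForm B (g (B i))) fun i => linForm_isHomogeneous B _
  rwa [one_mul] at this

theorem polyAct_mem_degLT (g : V ≃ₗ[ℂ] V) {m : ℤ} {f : MvPolynomial ι ℂ}
    (hf : f ∈ degLT ι m) : polyAct B g f ∈ degLT ι m := by
  refine degLT_le (W := (degLT ι m).comap (polyAct B g).toLinearMap) (fun n hn f hf => ?_) hf
  exact IsHomogeneous.mem_degLT (polyAct_isHomogeneous B g hf) hn

theorem homogeneousComponent_polyAct (g : V ≃ₗ[ℂ] V) (n : ℕ) (f : MvPolynomial ι ℂ) :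
    homogeneousComponent n (polyAct B g f) = polyAct B g (homogeneousComponent n f) := by
  refine mem_of_forall_isHomogeneous
    (W := LinearMap.eqLocus (homogeneousComponent n ∘ₗ (polyAct B g).toLinearMap)
      ((polyAct B g).toLinearMap ∘ₗ homogeneousComponent n)) (fun k f hf => ?_) f
  change homogeneousComponent n (polyAct B g f) = polyAct B g (homogeneousComponent n f)
  rw [homogeneousComponent_of_mem hf,
    homogeneousComponent_of_mem (polyAct_isHomogeneous B g hf)]
  split_ifs <;> simp

/-- The chain rule for a linear substitution. -/
theorem pderiv_polyAct (g : V ≃ₗ[ℂ] V) (j : ι) (f : MvPolynomial ι ℂ) :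
    pderiv j (polyAct B g f) = ∑ i, B.repr (g (B i)) j • polyAct B g (pderiv i f) := by
  classical
  induction f using MvPolynomial.induction_on with
  | C r =>
    have hC : polyAct B g (C r) = C r := (polyAct B g).commutes r
    simp [hC]
  | add p q hp hq => simp only [map_add, hp, hq, smul_add, Finset.sum_add_distrib]
  | mul_X p k hp =>
    have h : ∀ i, B.repr (g (B i)) j • polyAct B g (pderiv i (p * X k)) =
        polyAct B g p * (B.repr (g (B i)) j • C ((Pi.single k 1 : ι → ℂ) i)) +
          polyAct B g (X k) * (B.repr (g (B i)) j • polyAct B g (pderiv i p)) := by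
      intro i
      have hX : pderiv i (X k : MvPolynomial ι ℂ) = C ((Pi.single k 1 : ι → ℂ) i) := by
        rw [pderiv_X, Pi.single_comm]
        by_cases hik : i = k <;> simp [hik]
      have hC : ∀ r, polyAct B g (C r) = C r := fun r => (polyAct B g).commutes r
      rw [Derivation.leibniz, map_add, smul_eq_mul, smul_eq_mul, map_mul, map_mul, hX, hC,
        smul_add, mul_smul_comm, mul_smul_comm]
    rw [map_mul, Derivation.leibniz, hp, polyAct_X, pderiv_linForm]
    simp only [h, Finset.sum_add_distrib, ← Finset.mul_sum, smul_eq_mul, polyAct_X]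
    congr 2
    rw [Finset.sum_eq_single k]
    · simp [smul_eq_C_mul]
    · intro i _ hi
      simp [hi]
    · simp

/-- The canonical element `∑ x_i ⊗ ∂_i` is invariant under `GL(V)`. -/
theorem sum_basis_pderiv_polyAct {W : Type*} [AddCommGroup W] [Module ℂ W]
    (β : V →ₗ[ℂ] MvPolynomial ι ℂ →ₗ[ℂ] W) (g : V ≃ₗ[ℂ] V) (f : MvPolynomial ι ℂ) :
    ∑ i, β (g (B i)) (polyAct B g (pderiv i f)) = ∑ i, β (B i) (pderiv i (polyAct B g f)) := by
  simp only [pderiv_polyAct, map_sum, map_smul]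
  rw [Finset.sum_comm]
  refine Finset.sum_congr rfl fun i _ => ?_
  exact (sum_repr_smul_apply B (β.flip (polyAct B g (pderiv i f))) (g (B i))).symm

/-- Euler's identity. -/
theorem sum_linForm_mul_pderiv {f : MvPolynomial ι ℂ} {n : ℕ} (hf : f.IsHomogeneous n) :
    ∑ i, linForm B (B i) * pderiv i f = (n : ℂ) • f := by
  simp only [linForm_basis]
  rw [hf.sum_X_mul_pderiv, Nat.cast_smul_eq_nsmul]

end LinearAction

/-! ### The polynomial representation (PBW) -/

section Operators

variable {V : Type*} [AddCommGroup V] [Module ℂ V] {ι : Type*} [Fintype ι]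
  (B : Module.Basis ι ℂ V) {G : Subgroup (V ≃ₗ[ℂ] V)}

/-- The action of the group algebra `ℂG` on the polynomial algebra. -/
def groupAct (G : Subgroup (V ≃ₗ[ℂ] V)) :
    MonoidAlgebra ℂ G →ₐ[ℂ] Module.End ℂ (MvPolynomial ι ℂ) :=
  MonoidAlgebra.lift ℂ (Module.End ℂ (MvPolynomial ι ℂ)) G
    { toFun := fun g => (polyAct B (g : V ≃ₗ[ℂ] V)).toLinearMap
      map_one' := LinearMap.ext fun f => polyAct_one_apply B f
      map_mul' := fun _ _ => LinearMap.ext fun f => polyAct_mul_apply B _ _ f }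

@[simp]
theorem groupAct_single (g : G) (r : ℂ) (f : MvPolynomial ι ℂ) :
    groupAct B G (MonoidAlgebra.single g r) f = r • polyAct B (g : V ≃ₗ[ℂ] V) f := by
  rw [groupAct, MonoidAlgebra.lift_single]
  rfl

theorem groupAct_mem_degLT (x : MonoidAlgebra ℂ G) {m : ℤ} {f : MvPolynomial ι ℂ}
    (hf : f ∈ degLT ι m) : groupAct B G x f ∈ degLT ι m := by
  induction x using MonoidAlgebra.induction_linear with
  | zero => simp
  | add x y hx hy =>
    rw [map_add]
    exact Submodule.add_mem _ hx hy
  | single g r =>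
    rw [groupAct_single]
    exact Submodule.smul_mem _ _ (polyAct_mem_degLT B _ hf)

variable (κ : V →ₗ[ℂ] V →ₗ[ℂ] MonoidAlgebra ℂ G)

/-- `κ` is skew-symmetric. -/
def IsSkew : Prop := ∀ v w, κ v w = - κ w v

/-- `κ(g v, g w) = g κ(v, w) g⁻¹` for `g ∈ G`. -/
def IsEquivariant : Prop :=
  ∀ (g : G) (v w : V), κ ((g : V ≃ₗ[ℂ] V) v) ((g : V ≃ₗ[ℂ] V) w) * MonoidAlgebra.of ℂ G g =
    MonoidAlgebra.of ℂ G g * κ v w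

/-- The Jacobi identity for the commutators `[v, w] = κ(v, w)`: for each `g`, the coefficients of
`g` in `[κ(v, w), z] + [κ(w, z), v] + [κ(z, v), w]` add up to zero. -/
def IsJacobi : Prop :=
  ∀ (g : G) (v w z : V), (κ v w).coeff g • ((g : V ≃ₗ[ℂ] V) z - z) +
    (κ w z).coeff g • ((g : V ≃ₗ[ℂ] V) v - v) +
    (κ z v).coeff g • ((g : V ≃ₗ[ℂ] V) w - w) = 0

/-- The finite approximations of the operators `lowerOp`: the `k`-th one is correct in
degrees `< k`. -/
def lowerAux : ℕ → V →ₗ[ℂ] Module.End ℂ (MvPolynomial ι ℂ)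
  | 0 => 0
  | k + 1 => ∑ i, LinearMap.mulRight ℂ (A := Module.End ℂ (MvPolynomial ι ℂ))
      ((pderiv (R := ℂ) i).toLinearMap ∘ₗ eulerInv ι) ∘ₗ
      (LinearMap.mulLeft ℂ (LinearMap.mulLeft ℂ (linForm B (B i)) + lowerAux k (B i)) ∘ₗ
        lowerAux k + (groupAct B G).toLinearMap ∘ₗ κ.flip (B i))

theorem lowerAux_succ_apply (k : ℕ) (v : V) (f : MvPolynomial ι ℂ) :
    lowerAux B κ (k + 1) v f = ∑ i,
      (linForm B (B i) * lowerAux B κ k v (pderiv i (eulerInv ι f)) +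
        lowerAux B κ k (B i) (lowerAux B κ k v (pderiv i (eulerInv ι f))) +
        groupAct B G (κ v (B i)) (pderiv i (eulerInv ι f))) := by
  simp only [lowerAux, LinearMap.sum_apply]
  rfl

/-- The approximations lower degrees, and from the `k`-th one on they agree on polynomials of degree
`< k`, because the recursion differentiates its argument. -/
theorem lowerAux_mem_and_succ (k : ℕ) :
    ∀ m : ℤ, m ≤ k → ∀ f ∈ degLT ι m, ∀ v, lowerAux B κ k v f ∈ degLT ι (m - 1) ∧
      lowerAux B κ (k + 1) v f = lowerAux B κ k v f := by
  induction k with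
  | zero =>
    intro m hm f hf v
    rw [eq_zero_of_mem_degLT (by simpa using hm) hf]
    simp
  | succ k ih =>
    intro m hm f hf v
    push_cast at hm
    have hg : ∀ i, pderiv i (eulerInv ι f) ∈ degLT ι (m - 1) := fun i =>
      pderiv_mem_degLT i (eulerInv_mem_degLT hf)
    have h1 := fun i => ih (m - 1) (by omega) _ (hg i) v
    have h2 := fun i => ih (m - 1 - 1) (by omega) _ (h1 i).1 (B i)
    constructor
    · rw [lowerAux_succ_apply]
      refine Submodule.sum_mem _ fun i _ => ?_
      refine Submodule.add_mem _ (Submodule.add_mem _ ?_ ?_) (groupAct_mem_degLT B _ (hg i))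
      · exact mul_mem_degLT (linForm_mem_degLT B _) (h1 i).1 (by omega)
      · exact degLT_mono (by omega) (h2 i).1
    · rw [lowerAux_succ_apply, lowerAux_succ_apply B κ k]
      refine Finset.sum_congr rfl fun i _ => ?_
      rw [(h1 i).2, (h2 i).2]

theorem lowerAux_eq {k l : ℕ} (h : k ≤ l) {f : MvPolynomial ι ℂ} (hf : f ∈ degLT ι k) (v : V) :
    lowerAux B κ l v f = lowerAux B κ k v f := by
  induction l, h using Nat.le_induction with
  | base => rfl
  | succ l hl ih => rw [(lowerAux_mem_and_succ B κ l k (by omega) f hf v).2, ih]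

/-- The degree lowering part `Y_v` of the action of `v ∈ V` on the polynomial algebra. It is
determined by `(n + 1) Y_v f = ∑ (x_i + Y_{x_i}) Y_v ∂_i f + κ(v, x_i) ∂_i f` for `f` homogeneous of
degree `n`. -/
def lowerOp : V →ₗ[ℂ] Module.End ℂ (MvPolynomial ι ℂ) :=
  LinearMap.mk₂ ℂ (fun v f => lowerAux B κ (f.totalDegree + 1) v f)
    (fun v w f => by simp) (fun r v f => by simp)
    (fun v f g => by
      have h : ∀ p : MvPolynomial ι ℂ, p ∈ degLT ι ((p.totalDegree + 1 : ℕ) : ℤ) := fun p => by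
        push_cast
        exact exists_mem_degLT p
      rw [← lowerAux_eq B κ (le_max_left _ (max (f.totalDegree + 1) (g.totalDegree + 1))) (h _),
        ← lowerAux_eq B κ (l := max ((f + g).totalDegree + 1)
          (max (f.totalDegree + 1) (g.totalDegree + 1))) (by omega) (h f),
        ← lowerAux_eq B κ (l := max ((f + g).totalDegree + 1)
          (max (f.totalDegree + 1) (g.totalDegree + 1))) (by omega) (h g), map_add])
    (fun r v f => by
      have h : ∀ p : MvPolynomial ι ℂ, p ∈ degLT ι ((p.totalDegree + 1 : ℕ) : ℤ) := fun p => by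
        push_cast
        exact exists_mem_degLT p
      rw [← lowerAux_eq B κ (le_max_left _ (f.totalDegree + 1)) (h _),
        ← lowerAux_eq B κ (le_max_right ((r • f).totalDegree + 1) (f.totalDegree + 1)) (h f),
        map_smul])

theorem lowerOp_eq {k : ℕ} {f : MvPolynomial ι ℂ} (hf : f ∈ degLT ι k) (v : V) :
    lowerOp B κ v f = lowerAux B κ k v f := by
  change lowerAux B κ (f.totalDegree + 1) v f = _
  have h : f ∈ degLT ι ((f.totalDegree + 1 : ℕ) : ℤ) := by
    push_cast
    exact exists_mem_degLT f
  rw [← lowerAux_eq B κ (le_max_left _ k) h,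
    ← lowerAux_eq B κ (le_max_right (f.totalDegree + 1) k) hf]

theorem lowerOp_mem_degLT (v : V) {m : ℤ} {f : MvPolynomial ι ℂ} (hf : f ∈ degLT ι m) :
    lowerOp B κ v f ∈ degLT ι (m - 1) := by
  obtain hm | hm := le_total m 0
  · rw [eq_zero_of_mem_degLT hm hf, map_zero]
    exact Submodule.zero_mem _
  · lift m to ℕ using hm
    rw [lowerOp_eq B κ hf]
    exact (lowerAux_mem_and_succ B κ m m le_rfl f hf v).1

/-- The operator `X_v = v + Y_v` by which `v ∈ V` acts on the polynomial algebra. -/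
def vecOp : V →ₗ[ℂ] Module.End ℂ (MvPolynomial ι ℂ) :=
  LinearMap.mul ℂ (MvPolynomial ι ℂ) ∘ₗ linForm B + lowerOp B κ

theorem vecOp_apply (v : V) (f : MvPolynomial ι ℂ) :
    vecOp B κ v f = linForm B v * f + lowerOp B κ v f := rfl

theorem vecOp_mem_degLT (v : V) {m : ℤ} {f : MvPolynomial ι ℂ} (hf : f ∈ degLT ι m) :
    vecOp B κ v f ∈ degLT ι (m + 1) :=
  Submodule.add_mem _ (mul_mem_degLT (linForm_mem_degLT B v) hf (by omega))
    (degLT_mono (by omega) (lowerOp_mem_degLT B κ v hf))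

/-- The recursion that characterizes `Y_v`. -/
theorem natCast_add_one_smul_lowerOp (v : V) {n : ℕ} {f : MvPolynomial ι ℂ}
    (hf : f.IsHomogeneous n) :
    ((n : ℂ) + 1) • lowerOp B κ v f = ∑ i, (vecOp B κ (B i) (lowerOp B κ v (pderiv i f)) +
      groupAct B G (κ v (B i)) (pderiv i f)) := by
  have hn : (n : ℂ) + 1 ≠ 0 := Nat.cast_add_one_ne_zero n
  have hf' : f ∈ degLT ι ((n + 1 : ℕ) : ℤ) := IsHomogeneous.mem_degLT hf (by omega)
  have hd : ∀ i, pderiv i f ∈ degLT ι (n : ℤ) := fun i => by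
    simpa using pderiv_mem_degLT i hf'
  rw [lowerOp_eq B κ hf', lowerAux_succ_apply, Finset.smul_sum]
  refine Finset.sum_congr rfl fun i _ => ?_
  have h1 := lowerOp_mem_degLT B κ v (hd i)
  have h2 : lowerOp B κ v (pderiv i f) ∈ degLT ι (n : ℤ) := degLT_mono (by omega) h1
  rw [eulerInv_of_isHomogeneous hf]
  simp only [Derivation.map_smul, map_smul, ← lowerOp_eq B κ (hd i), ← lowerOp_eq B κ h2,
    vecOp_apply, smul_add, mul_smul_comm, smul_inv_smul₀ hn]

theorem pderiv_pderiv_comm (i j : ι) (f : MvPolynomial ι ℂ) :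
    pderiv i (pderiv j f) = pderiv j (pderiv i f) := by
  classical
  have h : ⁅pderiv (R := ℂ) i, pderiv (R := ℂ) j⁆ = 0 := by
    refine derivation_ext fun k => ?_
    rw [Derivation.commutator_apply]
    simp [pderiv_X, Pi.single_apply, apply_ite]
  have := DFunLike.congr_fun h f
  rw [Derivation.commutator_apply, Derivation.zero_apply, sub_eq_zero] at this
  exact this

/-- The normalization `∑ Y_{x_i} ∂_i = 0` (the map `S(V) → A` is symmetrization). -/
theorem sum_lowerOp_pderiv (halt : IsSkew κ) (n : ℕ) :
    ∀ f : MvPolynomial ι ℂ, f.IsHomogeneous n →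
      ∑ i, lowerOp B κ (B i) (pderiv i f) = 0 := by
  induction n with
  | zero =>
    intro f hf
    simp [IsHomogeneous.pderiv_eq_zero hf]
  | succ n ih =>
    intro f hf
    have hn : (n : ℂ) + 1 ≠ 0 := Nat.cast_add_one_ne_zero n
    have hd := isHomogeneous_of_succ_pderiv hf
    refine (smul_eq_zero_iff_right hn).1 ?_
    rw [Finset.smul_sum]
    simp only [natCast_add_one_smul_lowerOp B κ _ (hd _), Finset.sum_add_distrib]
    have h1 : ∑ i, ∑ j, vecOp B κ (B j) (lowerOp B κ (B i) (pderiv j (pderiv i f))) = 0 := by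
      rw [Finset.sum_comm]
      refine Finset.sum_eq_zero fun j _ => ?_
      rw [← map_sum]
      simp only [pderiv_pderiv_comm j]
      rw [ih _ (hd j), map_zero]
    have h2 : ∑ i, ∑ j, groupAct B G (κ (B i) (B j)) (pderiv j (pderiv i f)) = 0 := by
      refine self_eq_neg.1 ?_
      conv_lhs => rw [Finset.sum_comm]
      rw [← Finset.sum_neg_distrib]
      refine Finset.sum_congr rfl fun j _ => ?_
      rw [← Finset.sum_neg_distrib]
      refine Finset.sum_congr rfl fun i _ => ?_
      rw [halt, pderiv_pderiv_comm, map_neg, LinearMap.neg_apply]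
    rw [h1, h2, add_zero]

theorem sum_vecOp_pderiv (halt : IsSkew κ) {n : ℕ} {f : MvPolynomial ι ℂ}
    (hf : f.IsHomogeneous n) : ∑ i, vecOp B κ (B i) (pderiv i f) = (n : ℂ) • f := by
  simp only [vecOp_apply, Finset.sum_add_distrib]
  rw [sum_lowerOp_pderiv B κ halt n f hf, add_zero, sum_linForm_mul_pderiv B hf]

/-- Equivariance of `Y_v`. The recursion contracts over a basis of `V`, so it does not depend on the
basis and commutes with the group action. -/
theorem polyAct_lowerOp
    (hequiv : IsEquivariant κ) (g : G) (k : ℕ) :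
    ∀ f ∈ degLT ι k, ∀ v, polyAct B (g : V ≃ₗ[ℂ] V) (lowerOp B κ v f) =
      lowerOp B κ ((g : V ≃ₗ[ℂ] V) v) (polyAct B (g : V ≃ₗ[ℂ] V) f) := by
  induction k with
  | zero =>
    intro f hf v
    rw [eq_zero_of_mem_degLT (by simp) hf]
    simp
  | succ k ih =>
    intro f hf v
    refine degLT_le (W := LinearMap.eqLocus
      ((polyAct B (g : V ≃ₗ[ℂ] V)).toLinearMap ∘ₗ lowerOp B κ v)
      (lowerOp B κ ((g : V ≃ₗ[ℂ] V) v) ∘ₗ (polyAct B (g : V ≃ₗ[ℂ] V)).toLinearMap))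
      (fun n hn f hf => ?_) hf
    change polyAct B (g : V ≃ₗ[ℂ] V) (lowerOp B κ v f) =
      lowerOp B κ ((g : V ≃ₗ[ℂ] V) v) (polyAct B (g : V ≃ₗ[ℂ] V) f)
    have hn' : (n : ℂ) + 1 ≠ 0 := Nat.cast_add_one_ne_zero n
    have hd : ∀ i, pderiv i f ∈ degLT ι (k : ℤ) := fun i =>
      degLT_mono (by push_cast; omega) (pderiv_mem_degLT i (IsHomogeneous.mem_degLT hf hn))
    have hd' : ∀ i, lowerOp B κ v (pderiv i f) ∈ degLT ι (k : ℤ) := fun i =>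
      degLT_mono (by omega) (lowerOp_mem_degLT B κ v (hd i))
    refine smul_right_injective _ hn' ?_
    simp only
    rw [← map_smul, natCast_add_one_smul_lowerOp B κ v hf,
      natCast_add_one_smul_lowerOp B κ _ (polyAct_isHomogeneous B _ hf), map_sum]
    have key := sum_basis_pderiv_polyAct B
      (LinearMap.mulRight ℂ (A := Module.End ℂ (MvPolynomial ι ℂ))
        (lowerOp B κ ((g : V ≃ₗ[ℂ] V) v)) ∘ₗ vecOp B κ +
        (groupAct B G).toLinearMap ∘ₗ κ ((g : V ≃ₗ[ℂ] V) v)) (g : V ≃ₗ[ℂ] V) f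
    refine Eq.trans (Finset.sum_congr rfl fun i _ => ?_) key
    change _ = vecOp B κ ((g : V ≃ₗ[ℂ] V) (B i)) (lowerOp B κ ((g : V ≃ₗ[ℂ] V) v)
        (polyAct B (g : V ≃ₗ[ℂ] V) (pderiv i f))) +
      groupAct B G (κ ((g : V ≃ₗ[ℂ] V) v) ((g : V ≃ₗ[ℂ] V) (B i)))
        (polyAct B (g : V ≃ₗ[ℂ] V) (pderiv i f))
    rw [map_add, vecOp_apply, map_add, map_mul, polyAct_linForm, ih _ (hd' i), ih _ (hd i),
      vecOp_apply]
    congr 1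
    have := congrArg (fun x => groupAct B G x (pderiv i f)) (hequiv g v (B i))
    simpa [Module.End.mul_apply] using this.symm

theorem polyAct_vecOp
    (hequiv : IsEquivariant κ) (g : G) (v : V)
    (f : MvPolynomial ι ℂ) : polyAct B (g : V ≃ₗ[ℂ] V) (vecOp B κ v f) =
      vecOp B κ ((g : V ≃ₗ[ℂ] V) v) (polyAct B (g : V ≃ₗ[ℂ] V) f) := by
  rw [vecOp_apply, vecOp_apply, map_add, map_mul, polyAct_linForm,
    polyAct_lowerOp B κ hequiv g (f.totalDegree + 1) f (by
      push_cast
      exact exists_mem_degLT f)]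

theorem groupAct_vecOp_sub [Fintype G]
    (hequiv : IsEquivariant κ)
    (x : MonoidAlgebra ℂ G) (z : V) (f : MvPolynomial ι ℂ) :
    groupAct B G x (vecOp B κ z f) - vecOp B κ z (groupAct B G x f) =
      ∑ g : G, vecOp B κ (x.coeff g • ((g : V ≃ₗ[ℂ] V) z - z)) (polyAct B (g : V ≃ₗ[ℂ] V) f) := by
  classical
  induction x using MonoidAlgebra.induction_linear with
  | zero => simp
  | add x y hx hy =>
    simp only [map_add, LinearMap.add_apply, MonoidAlgebra.coeff_add, Finsupp.add_apply, add_smul,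
      Finset.sum_add_distrib, ← hx, ← hy]
    abel
  | single g r =>
    rw [Finset.sum_eq_single g]
    · simp [polyAct_vecOp B κ hequiv, smul_sub]
    · intro h _ hne
      simp [MonoidAlgebra.coeff_single, hne.symm]
    · simp

/-- The failure of the relation `[v, w] = κ(v, w)` for the operators `X_v`. -/
def defect (v w : V) : Module.End ℂ (MvPolynomial ι ℂ) :=
  vecOp B κ v * vecOp B κ w - vecOp B κ w * vecOp B κ v - groupAct B G (κ v w)

theorem defect_apply (v w : V) (f : MvPolynomial ι ℂ) :
    defect B κ v w f = vecOp B κ v (vecOp B κ w f) - vecOp B κ w (vecOp B κ v f) -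
      groupAct B G (κ v w) f := rfl

theorem defect_swap (halt : IsSkew κ) (v w : V) (f : MvPolynomial ι ℂ) :
    defect B κ v w f = - defect B κ w v f := by
  rw [defect_apply, defect_apply, halt v w, map_neg, LinearMap.neg_apply]
  abel

theorem sum_repr_smul_defect (v w : V) (f : MvPolynomial ι ℂ) :
    ∑ i, defect B κ v (B i) (B.repr w i • f) = defect B κ v w f := by
  have := sum_repr_smul_apply B
    (LinearMap.mulLeft ℂ (A := Module.End ℂ (MvPolynomial ι ℂ)) (vecOp B κ v) ∘ₗ vecOp B κ -
      LinearMap.mulRight ℂ (A := Module.End ℂ (MvPolynomial ι ℂ)) (vecOp B κ v) ∘ₗ vecOp B κ -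
      (groupAct B G).toLinearMap ∘ₗ κ v) w
  have h2 := congrArg (fun P : Module.End ℂ (MvPolynomial ι ℂ) => P f) this
  simp only [LinearMap.sum_apply, LinearMap.smul_apply] at h2
  simp only [map_smul]
  exact h2

/-- The defect vanishes on the component of `⋀²V ⊗ SⁿV` that the recursion for `Y_v` controls. -/
theorem sum_defect_pderiv (halt : IsSkew κ) (v : V) {n : ℕ}
    {f : MvPolynomial ι ℂ} (hf : f.IsHomogeneous n) :
    ∑ i, defect B κ v (B i) (pderiv i f) = 0 := by
  have h1 : ∑ i, vecOp B κ v (vecOp B κ (B i) (pderiv i f)) = (n : ℂ) • vecOp B κ v f := by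
    rw [← map_sum, sum_vecOp_pderiv B κ halt hf, map_smul]
  have h2 : ∑ i, vecOp B κ (B i) (linForm B v * pderiv i f) =
      ((n : ℂ) + 1) • (linForm B v * f) - vecOp B κ v f := by
    have hvf : (linForm B v * f).IsHomogeneous (1 + n) := (linForm_isHomogeneous B v).mul hf
    have := sum_vecOp_pderiv B κ halt hvf
    simp only [Derivation.leibniz, pderiv_linForm, smul_eq_mul, map_add,
      Finset.sum_add_distrib] at this
    have h3 : ∑ i, vecOp B κ (B i) (f * C (B.repr v i)) = vecOp B κ v f := by
      have := congrArg (fun P : Module.End ℂ (MvPolynomial ι ℂ) => P f)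
        (sum_repr_smul_apply B (vecOp B κ) v)
      simp only [LinearMap.sum_apply, LinearMap.smul_apply] at this
      rw [← this]
      refine Finset.sum_congr rfl fun i _ => ?_
      rw [mul_comm, ← smul_eq_C_mul, map_smul]
    rw [h3] at this
    rw [eq_sub_iff_add_eq, this]
    push_cast
    rw [add_comm]
  have h3 := natCast_add_one_smul_lowerOp B κ v hf
  have h4 : ∀ i, defect B κ v (B i) (pderiv i f) = vecOp B κ v (vecOp B κ (B i) (pderiv i f)) -
      vecOp B κ (B i) (linForm B v * pderiv i f) -
      (vecOp B κ (B i) (lowerOp B κ v (pderiv i f)) +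
        groupAct B G (κ v (B i)) (pderiv i f)) := by
    intro i
    rw [defect_apply, vecOp_apply B κ v (pderiv i f), map_add]
    abel
  simp only [h4, Finset.sum_sub_distrib]
  rw [h1, h2, ← h3, vecOp_apply]
  module

/-- `sum_defect_pderiv` applied to the product of `w` and `f`, expanded by the Leibniz rule. -/
theorem sum_defect_linForm_mul_pderiv (halt : IsSkew κ) (v w : V) {n : ℕ}
    {f : MvPolynomial ι ℂ} (hf : f.IsHomogeneous n) :
    ∑ i, defect B κ v (B i) (linForm B w * pderiv i f) = - defect B κ v w f := by
  have h := sum_defect_pderiv B κ halt v ((linForm_isHomogeneous B w).mul hf)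
  simp only [Derivation.leibniz, pderiv_linForm, smul_eq_mul, map_add,
    Finset.sum_add_distrib] at h
  rw [← sum_repr_smul_defect, eq_neg_iff_add_eq_zero, ← h]
  refine congrArg (_ + ·) (Finset.sum_congr rfl fun i _ => ?_)
  rw [mul_comm, ← smul_eq_C_mul]

/-- **The PBW property**: if `κ` is skew-symmetric, equivariant and satisfies the Jacobi identity,
then the operators `X_v` satisfy `[X_v, X_w] = κ(v, w)`. -/
theorem defect_eq_zero [Fintype G] (halt : IsSkew κ)
    (hequiv : IsEquivariant κ)
    (hjac : IsJacobi κ) (k : ℕ) :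
    ∀ f ∈ degLT ι k, ∀ v w, defect B κ v w f = 0 := by
  induction k with
  | zero =>
    intro f hf v w
    rw [eq_zero_of_mem_degLT (by simp) hf, map_zero]
  | succ k ih =>
    intro f hf v w
    refine degLT_le (W := LinearMap.ker (defect B κ v w)) (fun n hn f hf => ?_) hf
    rw [LinearMap.mem_ker]
    have hd : ∀ i, pderiv i f ∈ degLT ι (k : ℤ) := fun i =>
      degLT_mono (by push_cast; omega) (pderiv_mem_degLT i (IsHomogeneous.mem_degLT hf hn))
    -- The Jacobi identity for commutators, applied to a polynomial of lower degree.
    have hcyc : ∀ i, defect B κ v w (vecOp B κ (B i) (pderiv i f)) +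
        defect B κ w (B i) (vecOp B κ v (pderiv i f)) +
        defect B κ (B i) v (vecOp B κ w (pderiv i f)) = 0 := by
      intro i
      have e1 := congrArg (vecOp B κ (B i)) (ih _ (hd i) v w)
      have e2 := congrArg (vecOp B κ v) (ih _ (hd i) w (B i))
      have e3 := congrArg (vecOp B κ w) (ih _ (hd i) (B i) v)
      have e4 : (groupAct B G (κ v w) (vecOp B κ (B i) (pderiv i f)) -
          vecOp B κ (B i) (groupAct B G (κ v w) (pderiv i f))) +
          (groupAct B G (κ w (B i)) (vecOp B κ v (pderiv i f)) -
          vecOp B κ v (groupAct B G (κ w (B i)) (pderiv i f))) +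
          (groupAct B G (κ (B i) v) (vecOp B κ w (pderiv i f)) -
          vecOp B κ w (groupAct B G (κ (B i) v) (pderiv i f))) = 0 := by
        simp only [groupAct_vecOp_sub B κ hequiv, ← Finset.sum_add_distrib,
          ← LinearMap.add_apply, ← map_add, hjac _ v w (B i)]
        simp
      simp only [defect_apply, map_sub, map_zero] at e1 e2 e3 ⊢
      rw [← sub_eq_zero] at e1 e2 e3
      linear_combination (exp := 1) e1 + e2 + e3 - e4
    -- Lower order terms may be dropped from the arguments of the defect.
    have hlow : ∀ (a b u : V) (i : ι), defect B κ a b (vecOp B κ u (pderiv i f)) =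
        defect B κ a b (linForm B u * pderiv i f) := by
      intro a b u i
      rw [vecOp_apply, map_add,
        ih _ (degLT_mono (by omega) (lowerOp_mem_degLT B κ u (hd i))), add_zero]
    have hsum := Finset.sum_congr (s₁ := Finset.univ) rfl fun i _ => hcyc i
    rw [Finset.sum_const_zero, Finset.sum_add_distrib, Finset.sum_add_distrib, ← map_sum,
      sum_vecOp_pderiv B κ halt hf] at hsum
    simp only [hlow, defect_swap B κ halt (B _) v, Finset.sum_neg_distrib] at hsum
    rw [sum_defect_linForm_mul_pderiv B κ halt w v hf,
      sum_defect_linForm_mul_pderiv B κ halt v w hf,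
        defect_swap B κ halt w v, neg_neg, map_smul] at hsum
    have hn2 : (n : ℂ) + 2 ≠ 0 := by exact_mod_cast (by omega : n + 2 ≠ 0)
    refine (smul_eq_zero_iff_right hn2).1 ?_
    rw [← hsum]
    module

end Operators

/-! ### Endomorphisms of the polynomial algebra over the invariants -/

section Invariants

variable {V : Type*} [AddCommGroup V] [Module ℂ V] {ι : Type*} [Fintype ι]
  (B : Module.Basis ι ℂ V) (G : Subgroup (V ≃ₗ[ℂ] V))

theorem exists_smul_eq_of_dvd_linForm {p : MvPolynomial ι ℂ} (hp : ¬ IsUnit p) {v : V}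
    (hv : v ≠ 0) (h : p ∣ linForm B v) : ∃ r : ℂ, r ≠ 0 ∧ linForm B v = r • p := by
  obtain ⟨q, hq⟩ := h
  have hne : linForm B v ≠ 0 := fun h0 => hv (linForm_injective B (by rw [h0, map_zero]))
  have hp0 : p ≠ 0 := by rintro rfl; simp [hq] at hne
  have hq0 : q ≠ 0 := by rintro rfl; simp [hq] at hne
  have hdeg := (linForm_isHomogeneous B v).totalDegree hne
  rw [hq, totalDegree_mul_of_isDomain hp0 hq0] at hdeg
  have hpd : p.totalDegree ≠ 0 := by
    intro h0
    rw [totalDegree_eq_zero_iff_eq_C] at h0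
    refine hp ?_
    rw [h0]
    refine IsUnit.map C (isUnit_iff_ne_zero.2 fun hc => hp0 ?_)
    rw [h0, hc, map_zero]
  have hqd : q.totalDegree = 0 := by omega
  rw [totalDegree_eq_zero_iff_eq_C] at hqd
  refine ⟨coeff 0 q, fun hc => hq0 ?_, ?_⟩
  · rw [hqd, hc, map_zero]
  · rw [hq, smul_eq_C_mul, ← hqd, mul_comm]

theorem not_dvd_linForm_of_linearIndependent {p : MvPolynomial ι ℂ} (hp : ¬ IsUnit p) {v w : V}
    (h : LinearIndependent ℂ ![v, w]) : ¬ (p ∣ linForm B v ∧ p ∣ linForm B w) := by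
  rintro ⟨h1, h2⟩
  have hv : v ≠ 0 := h.ne_zero 0
  have hw : w ≠ 0 := h.ne_zero 1
  obtain ⟨r, hr, hrv⟩ := exists_smul_eq_of_dvd_linForm B hp hv h1
  obtain ⟨r', hr', hrw⟩ := exists_smul_eq_of_dvd_linForm B hp hw h2
  rw [LinearIndependent.pair_iff] at h
  refine hr' (h r' (-r) (linForm_injective B ?_)).1
  rw [map_add, map_smul, map_smul, hrv, hrw, map_zero]
  module

/-- `G` contains no reflections: `g - 1` has rank at least two for every `g ≠ 1` in `G`. -/
def NoReflections : Prop :=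
  ∀ g : G, g ≠ 1 → ∃ v w : V,
    LinearIndependent ℂ ![(g : V ≃ₗ[ℂ] V) v - v, (g : V ≃ₗ[ℂ] V) w - w]

variable {G}

/-- Without reflections, distinct elements of `G` stay distinct modulo every prime of `ℂ[V*]`. -/
theorem NoReflections.exists_not_dvd (hG : NoReflections G) {p : MvPolynomial ι ℂ}
    (hp : Prime p) {g h : G} (hgh : g ≠ h) :
    ∃ f, ¬ p ∣ polyAct B (g : V ≃ₗ[ℂ] V) f - polyAct B (h : V ≃ₗ[ℂ] V) f := by
  obtain ⟨v, w, hvw⟩ := hG (g * h⁻¹) fun h1 => hgh (mul_inv_eq_one.1 h1)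
  by_contra! hall
  refine not_dvd_linForm_of_linearIndependent B hp.not_isUnit hvw ?_
  have key : ∀ u : V, linForm B (((g * h⁻¹ : G) : V ≃ₗ[ℂ] V) u - u) =
      polyAct B (g : V ≃ₗ[ℂ] V) (linForm B ((h : V ≃ₗ[ℂ] V)⁻¹ u)) -
        polyAct B (h : V ≃ₗ[ℂ] V) (linForm B ((h : V ≃ₗ[ℂ] V)⁻¹ u)) := by
    intro u
    rw [polyAct_linForm, polyAct_linForm, ← map_sub]
    congr 2
    change u = ((h : V ≃ₗ[ℂ] V) * (h : V ≃ₗ[ℂ] V)⁻¹) u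
    rw [mul_inv_cancel]
    rfl
  exact ⟨by rw [key]; exact hall _, by rw [key]; exact hall _⟩

variable [Fintype G]

/-- Denominators can be cleared in twisted sums `∑ F_g g` when `G` contains no reflections: this is
Dedekind's independence of characters modulo each prime factor of the denominator. -/
theorem NoReflections.exists_eq_mul (hG : NoReflections G) (δ : MvPolynomial ι ℂ) :
    δ ≠ 0 → ∀ F : G → MvPolynomial ι ℂ,
      (∀ f, δ ∣ ∑ g : G, F g * polyAct B (g : V ≃ₗ[ℂ] V) f) → ∀ g, δ ∣ F g := by
  induction δ using UniqueFactorizationMonoid.induction_on_prime with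
  | h₁ => exact fun h => absurd rfl h
  | h₂ x hx => exact fun _ F _ g => hx.dvd
  | h₃ a p ha hp ih =>
    intro _ F hF
    have hdom : (Ideal.span {p}).IsPrime := (Ideal.span_singleton_prime hp.ne_zero).2 hp
    let χ : G → (MvPolynomial ι ℂ →* MvPolynomial ι ℂ ⧸ Ideal.span {p}) := fun g =>
      ((Ideal.Quotient.mk (Ideal.span {p})).comp
        (polyAct B (g : V ≃ₗ[ℂ] V)).toRingHom).toMonoidHom
    have hχ : Function.Injective χ := by
      intro g h hgh
      by_contra hne
      obtain ⟨f, hf⟩ := hG.exists_not_dvd B hp hne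
      refine hf (Ideal.mem_span_singleton.1 (Ideal.Quotient.eq.1 ?_))
      exact DFunLike.congr_fun hgh f
    have hlin := (linearIndependent_monoidHom (MvPolynomial ι ℂ)
      (MvPolynomial ι ℂ ⧸ Ideal.span {p})).comp χ hχ
    rw [Fintype.linearIndependent_iff] at hlin
    have hpF : ∀ g, p ∣ F g := by
      intro g
      rw [← Ideal.mem_span_singleton, ← Ideal.Quotient.eq_zero_iff_mem]
      refine hlin (fun g => Ideal.Quotient.mk _ (F g)) (funext fun f => ?_) g
      have h1 : p ∣ ∑ g : G, F g * polyAct B (g : V ≃ₗ[ℂ] V) f := (dvd_mul_right p a).trans (hF f)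
      rw [← Ideal.mem_span_singleton, ← Ideal.Quotient.eq_zero_iff_mem, map_sum] at h1
      simp only [Finset.sum_apply, Pi.zero_apply]
      rw [← h1]
      refine Finset.sum_congr rfl fun g _ => ?_
      rw [map_mul]
      rfl
    choose F' hF' using hpF
    intro g
    rw [hF' g]
    refine mul_dvd_mul_left p (ih ha F' (fun f => ?_) g)
    have h2 := hF f
    simp only [hF', mul_assoc, ← Finset.mul_sum] at h2
    exact (mul_dvd_mul_iff_left hp.ne_zero).1 h2

/-- The twisted group algebra `ℂ[V*] ∗ G` acts faithfully. -/
theorem eq_zero_of_sum_mul_polyAct {F : G → MvPolynomial ι ℂ}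
    (hF : ∀ f, ∑ g : G, F g * polyAct B (g : V ≃ₗ[ℂ] V) f = 0) (g : G) : F g = 0 := by
  let χ : G → (MvPolynomial ι ℂ →* MvPolynomial ι ℂ) := fun g =>
    (polyAct B (g : V ≃ₗ[ℂ] V)).toRingHom.toMonoidHom
  have hχ : Function.Injective χ := by
    intro g h hgh
    refine Subtype.ext (LinearEquiv.ext fun v => linForm_injective B ?_)
    rw [← polyAct_linForm, ← polyAct_linForm]
    exact DFunLike.congr_fun hgh (linForm B v)
  have hlin := (linearIndependent_monoidHom (MvPolynomial ι ℂ) (MvPolynomial ι ℂ)).comp χ hχ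
  rw [Fintype.linearIndependent_iff] at hlin
  refine hlin F (funext fun f => ?_) g
  rw [Pi.zero_apply, ← hF f, Finset.sum_apply]
  rfl

variable (G)

/-- A complex vector space is not a finite union of proper subspaces, so some vector has trivial
stabilizer. -/
theorem exists_apply_ne_self : ∃ v : V, ∀ g : G, g ≠ 1 → (g : V ≃ₗ[ℂ] V) v ≠ v := by
  by_contra! h
  obtain ⟨⟨g, hg⟩, hgt⟩ := Subspace.exists_eq_top_of_iUnion_eq_univ
    (p := fun g : {g : G // g ≠ 1} => fixedSpace ((g : G) : V ≃ₗ[ℂ] V)) (by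
      refine Set.eq_univ_of_forall fun v => ?_
      obtain ⟨g, hg, hgv⟩ := h v
      exact Set.mem_iUnion.2 ⟨⟨g, hg⟩, mem_fixedSpace.2 hgv⟩)
  refine hg (Subtype.ext (LinearEquiv.ext fun v => ?_))
  exact mem_fixedSpace.1 (hgt ▸ Submodule.mem_top)

variable {G}

/-- An endomorphism `ψ` of `ℂ[V*]` linear over the invariants is, up to a denominator, a twisted
sum `∑ F_g g`. For a vector `a ∈ V` with trivial stabilizer, the Lagrange interpolation polynomial
`∑ g(f) ∏_{k ≠ g} (T - k a)` has invariant coefficients; evaluating it at `T = a` expresses a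
multiple of `f` through the powers of `a`. -/
theorem exists_mul_apply_eq_sum (ψ : MvPolynomial ι ℂ →ₗ[ℂ] MvPolynomial ι ℂ)
    (hψ : ∀ u, (∀ g : G, polyAct B (g : V ≃ₗ[ℂ] V) u = u) → ∀ f, ψ (u * f) = u * ψ f) :
    ∃ δ : MvPolynomial ι ℂ, δ ≠ 0 ∧ ∃ F : G → MvPolynomial ι ℂ,
      ∀ f, δ * ψ f = ∑ g : G, F g * polyAct B (g : V ≃ₗ[ℂ] V) f := by
  classical
  obtain ⟨v, hv⟩ := exists_apply_ne_self G
  let a : G → MvPolynomial ι ℂ := fun g => linForm B ((g : V ≃ₗ[ℂ] V) v)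
  have ha : ∀ γ g : G, polyAct B (γ : V ≃ₗ[ℂ] V) (a g) = a (γ * g) := fun γ g =>
    polyAct_linForm B _ _
  let Q : G → Polynomial (MvPolynomial ι ℂ) := fun g =>
    ∏ k ∈ Finset.univ.erase g, (Polynomial.X - Polynomial.C (a k))
  let L : MvPolynomial ι ℂ → Polynomial (MvPolynomial ι ℂ) := fun f =>
    ∑ g : G, polyAct B (g : V ≃ₗ[ℂ] V) f • Q g
  have hQ : ∀ γ g : G, (Q g).map (polyAct B (γ : V ≃ₗ[ℂ] V)).toRingHom = Q (γ * g) := by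
    intro γ g
    rw [Polynomial.map_prod]
    refine Finset.prod_equiv (Equiv.mulLeft γ) (fun k => by simp) fun k _ => ?_
    rw [Polynomial.map_sub, Polynomial.map_X, Polynomial.map_C]
    exact congrArg (fun q => Polynomial.X - Polynomial.C q) (ha γ k)
  have hL : ∀ (γ : G) f, (L f).map (polyAct B (γ : V ≃ₗ[ℂ] V)).toRingHom = L f := by
    intro γ f
    rw [Polynomial.map_sum]
    refine Fintype.sum_equiv (Equiv.mulLeft γ) _ _ fun g => ?_
    rw [Polynomial.map_smul, hQ]
    exact congrArg (· • Q (γ * g)) (polyAct_mul_apply B _ _ f).symm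
  let δ : MvPolynomial ι ℂ := ∏ k ∈ Finset.univ.erase (1 : G), (a 1 - a k)
  have hδ : δ ≠ 0 := by
    refine Finset.prod_ne_zero_iff.2 fun k hk h0 => hv k (Finset.ne_of_mem_erase hk) ?_
    exact (linForm_injective B (sub_eq_zero.1 h0)).symm
  have heval : ∀ f, (L f).eval (a 1) = f * δ := by
    intro f
    rw [Polynomial.eval_finsetSum, Finset.sum_eq_single 1]
    · rw [Polynomial.eval_smul, Polynomial.eval_prod, smul_eq_mul, OneMemClass.coe_one,
        polyAct_one_apply]
      simp only [Polynomial.eval_sub, Polynomial.eval_X, Polynomial.eval_C, δ]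
    · intro g _ hg
      rw [Polynomial.eval_smul, Polynomial.eval_prod,
        Finset.prod_eq_zero (Finset.mem_erase.2 ⟨hg.symm, Finset.mem_univ 1⟩), smul_zero]
      rw [Polynomial.eval_sub, Polynomial.eval_X, Polynomial.eval_C, sub_self]
    · exact fun h => absurd (Finset.mem_univ _) h
  let Ψ : Polynomial (MvPolynomial ι ℂ) →ₗ[MvPolynomial ι ℂ] MvPolynomial ι ℂ :=
    (Polynomial.basisMonomials (MvPolynomial ι ℂ)).constr ℕ fun j => ψ (a 1 ^ j)
  have hΨ : ∀ P : Polynomial (MvPolynomial ι ℂ),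
      (∀ γ : G, P.map (polyAct B (γ : V ≃ₗ[ℂ] V)).toRingHom = P) →
      ψ (P.eval (a 1)) = Ψ P := by
    intro P hP
    conv_rhs => rw [P.as_sum_support]
    rw [Polynomial.eval_eq_sum, Polynomial.sum, map_sum, map_sum]
    refine Finset.sum_congr rfl fun j _ => ?_
    rw [hψ _ fun γ => ?_]
    · have : Polynomial.monomial j (P.coeff j) =
          P.coeff j • Polynomial.basisMonomials (MvPolynomial ι ℂ) j := by
        rw [Polynomial.coe_basisMonomials, Polynomial.smul_monomial, smul_eq_mul, mul_one]
      rw [this, map_smul, Module.Basis.constr_basis, smul_eq_mul]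
    · have := congrArg (fun q => q.coeff j) (hP γ)
      simp only [Polynomial.coeff_map] at this
      exact this
  have h1 : ∀ f, ψ (f * δ) = ∑ g : G, Ψ (Q g) * polyAct B (g : V ≃ₗ[ℂ] V) f := by
    intro f
    rw [← heval, hΨ _ fun γ => hL γ f, map_sum]
    refine Finset.sum_congr rfl fun g _ => ?_
    rw [map_smul, smul_eq_mul, mul_comm]
  -- The norm of `δ` is an invariant multiple of `δ`.
  let ε : MvPolynomial ι ℂ := ∏ g ∈ Finset.univ.erase (1 : G), polyAct B (g : V ≃ₗ[ℂ] V) δ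
  have hε : δ * ε = ∏ g : G, polyAct B (g : V ≃ₗ[ℂ] V) δ := by
    rw [← Finset.mul_prod_erase _ _ (Finset.mem_univ (1 : G)), OneMemClass.coe_one,
      polyAct_one_apply]
  refine ⟨δ * ε, ?_, fun g => Ψ (Q g) * polyAct B (g : V ≃ₗ[ℂ] V) ε, fun f => ?_⟩
  · rw [hε]
    refine Finset.prod_ne_zero_iff.2 fun g _ h0 =>
      hδ (polyAct_injective B (g : V ≃ₗ[ℂ] V) ?_)
    rw [h0, map_zero]
  · rw [← hψ _ fun γ => ?_]
    · rw [show δ * ε * f = ε * f * δ by ring, h1]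
      refine Finset.sum_congr rfl fun g _ => ?_
      rw [map_mul, mul_assoc]
    · rw [hε, map_prod]
      refine Fintype.prod_equiv (Equiv.mulLeft γ) _ _ fun g => ?_
      exact (polyAct_mul_apply B _ _ δ).symm

/-- If `G` contains no reflections, then every endomorphism of `ℂ[V*]` that is linear over the
invariants is given by an element of `ℂ[V*] ∗ G`. -/
theorem NoReflections.exists_eq_sum (hG : NoReflections G)
    (ψ : MvPolynomial ι ℂ →ₗ[ℂ] MvPolynomial ι ℂ)
    (hψ : ∀ u, (∀ g : G, polyAct B (g : V ≃ₗ[ℂ] V) u = u) → ∀ f, ψ (u * f) = u * ψ f) :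
    ∃ F : G → MvPolynomial ι ℂ, ∀ f, ψ f = ∑ g : G, F g * polyAct B (g : V ≃ₗ[ℂ] V) f := by
  obtain ⟨δ, hδ, F, hF⟩ := exists_mul_apply_eq_sum B ψ hψ
  have hdvd := hG.exists_eq_mul B δ hδ F fun f => ⟨ψ f, (hF f).symm⟩
  choose F' hF' using hdvd
  refine ⟨F', fun f => mul_left_cancel₀ hδ ?_⟩
  rw [hF, Finset.mul_sum]
  refine Finset.sum_congr rfl fun g _ => ?_
  rw [hF' g, mul_assoc]

end Invariants

/-! ### The filtration of `A` and symmetrization -/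

section Model

variable {V : Type*} [AddCommGroup V] [Module ℂ V] {ι : Type*} [Fintype ι]
  (B : Module.Basis ι ℂ V) {G : Subgroup (V ≃ₗ[ℂ] V)}
  (κ : V →ₗ[ℂ] V →ₗ[ℂ] MonoidAlgebra ℂ G)

/-- An algebra `A` generated by `V` and `ℂG` subject (at least) to the relations
`g v = g(v) g` and `[v, w] = κ(v, w)`, together with an action of `A` on the polynomial algebra for
which `v ∈ V` acts by `X_v` and `G` acts naturally. -/
structure PolynomialRep (A : Type*) [Ring A] [Algebra ℂ A] where
  /-- The map `V → A`. -/
  vec : V →ₗ[ℂ] A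
  /-- The map `ℂG → A`. -/
  grp : MonoidAlgebra ℂ G →ₐ[ℂ] A
  /-- The action of `A` on polynomials. -/
  act : A →ₐ[ℂ] Module.End ℂ (MvPolynomial ι ℂ)
  grp_mul_vec : ∀ (g : G) v, grp (MonoidAlgebra.of ℂ G g) * vec v =
    vec ((g : V ≃ₗ[ℂ] V) v) * grp (MonoidAlgebra.of ℂ G g)
  vec_mul_vec : ∀ v w, vec v * vec w - vec w * vec v = grp (κ v w)
  act_vec : ∀ v, act (vec v) = vecOp B κ v
  act_grp : ∀ x, act (grp x) = groupAct B G x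
  eq_top : ∀ W : Submodule ℂ A, 1 ∈ W → (∀ v, ∀ a ∈ W, vec v * a ∈ W) →
    (∀ x, ∀ a ∈ W, grp x * a ∈ W) → W = ⊤

namespace PolynomialRep

variable {B κ} {A : Type*} [Ring A] [Algebra ℂ A] (R : PolynomialRep B κ A)

/-- The filtration of `A` by the number of factors from `V`: `fil n` is spanned by the products
`v₁ ⋯ v_k g` with `k < n`. -/
def fil : ℕ → Submodule ℂ A
  | 0 => ⊥
  | n + 1 => LinearMap.range R.grp.toLinearMap ⊔
      ⨆ v, (fil n).map (LinearMap.mulLeft ℂ (R.vec v))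

theorem grp_mem_fil (n : ℕ) (x : MonoidAlgebra ℂ G) : R.grp x ∈ R.fil (n + 1) :=
  Submodule.mem_sup_left ⟨x, rfl⟩

theorem vec_mul_mem_fil {n : ℕ} {a : A} (ha : a ∈ R.fil n) (v : V) :
    R.vec v * a ∈ R.fil (n + 1) :=
  Submodule.mem_sup_right (Submodule.mem_iSup_of_mem v ⟨a, ha, rfl⟩)

theorem fil_succ_le {n : ℕ} {W : Submodule ℂ A} (h1 : ∀ x, R.grp x ∈ W)
    (h2 : ∀ v, ∀ a ∈ R.fil n, R.vec v * a ∈ W) : R.fil (n + 1) ≤ W := by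
  refine sup_le ?_ (iSup_le fun v => ?_)
  · rintro _ ⟨x, rfl⟩
    exact h1 x
  · rintro _ ⟨a, ha, rfl⟩
    exact h2 v a ha

theorem fil_le_succ (n : ℕ) : R.fil n ≤ R.fil (n + 1) := by
  induction n with
  | zero => exact bot_le
  | succ n ih =>
    exact R.fil_succ_le (R.grp_mem_fil _) fun v a ha => R.vec_mul_mem_fil (ih ha) v

theorem fil_mono : Monotone R.fil := monotone_nat_of_le_succ R.fil_le_succ

theorem grp_mul_mem_fil (n : ℕ) : ∀ a ∈ R.fil n, ∀ x, R.grp x * a ∈ R.fil n := by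
  induction n with
  | zero =>
    intro a ha x
    rw [(Submodule.mem_bot ℂ).1 ha, mul_zero]
    exact Submodule.zero_mem _
  | succ n ih =>
    intro a ha x
    refine R.fil_succ_le (W := (R.fil (n + 1)).comap (LinearMap.mulLeft ℂ (R.grp x)))
      (fun y => ?_) (fun v b hb => ?_) ha
    · change R.grp x * R.grp y ∈ R.fil (n + 1)
      rw [← map_mul]
      exact R.grp_mem_fil _ _
    · change R.grp x * (R.vec v * b) ∈ R.fil (n + 1)
      induction x using MonoidAlgebra.induction_linear with
      | zero =>
        rw [map_zero, zero_mul]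
        exact Submodule.zero_mem _
      | add x y hx hy =>
        rw [map_add, add_mul]
        exact Submodule.add_mem _ hx hy
      | single g r =>
        have : MonoidAlgebra.single g r = r • MonoidAlgebra.of ℂ G g := by simp
        rw [this, map_smul, smul_mul_assoc, ← mul_assoc, R.grp_mul_vec, mul_assoc]
        exact Submodule.smul_mem _ _ (R.vec_mul_mem_fil (ih b hb _) _)

theorem mul_grp_mem_fil (n : ℕ) : ∀ a ∈ R.fil n, ∀ x, a * R.grp x ∈ R.fil n := by
  induction n with
  | zero =>
    intro a ha x
    rw [(Submodule.mem_bot ℂ).1 ha, zero_mul]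
    exact Submodule.zero_mem _
  | succ n ih =>
    intro a ha x
    refine R.fil_succ_le (W := (R.fil (n + 1)).comap (LinearMap.mulRight ℂ (R.grp x)))
      (fun y => ?_) (fun v b hb => ?_) ha
    · change R.grp y * R.grp x ∈ R.fil (n + 1)
      rw [← map_mul]
      exact R.grp_mem_fil _ _
    · change R.vec v * b * R.grp x ∈ R.fil (n + 1)
      rw [mul_assoc]
      exact R.vec_mul_mem_fil (ih b hb x) v

theorem exists_mem_fil (a : A) : ∃ n, a ∈ R.fil n := by
  have hmem : ∀ b, b ∈ ⨆ n, R.fil n ↔ ∃ n, b ∈ R.fil n := fun b =>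
    Submodule.mem_iSup_of_directed _ R.fil_mono.directed_le
  rw [← hmem, R.eq_top (⨆ n, R.fil n)]
  · exact Submodule.mem_top
  · refine (hmem 1).2 ⟨1, ?_⟩
    rw [← map_one R.grp]
    exact R.grp_mem_fil 0 1
  · intro v b hb
    obtain ⟨n, hn⟩ := (hmem b).1 hb
    exact (hmem _).2 ⟨n + 1, R.vec_mul_mem_fil hn v⟩
  · intro x b hb
    obtain ⟨n, hn⟩ := (hmem b).1 hb
    exact (hmem _).2 ⟨n, R.grp_mul_mem_fil n b hn x⟩

/-- Symmetrization of homogeneous polynomials of degree `n` into `A`. (The values on other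
polynomials are irrelevant.) -/
def sym : ℕ → MvPolynomial ι ℂ →ₗ[ℂ] A
  | 0 => Algebra.linearMap ℂ A ∘ₗ lcoeff ℂ 0
  | n + 1 => ((n : ℂ) + 1)⁻¹ •
      ∑ i, LinearMap.mulLeft ℂ (R.vec (B i)) ∘ₗ sym n ∘ₗ (pderiv (R := ℂ) i).toLinearMap

theorem sym_zero_C (r : ℂ) : R.sym 0 (C r) = algebraMap ℂ A r := by
  simp [sym]

theorem sym_succ (n : ℕ) (f : MvPolynomial ι ℂ) :
    R.sym (n + 1) f = ((n : ℂ) + 1)⁻¹ • ∑ i, R.vec (B i) * R.sym n (pderiv i f) := by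
  simp only [sym, LinearMap.smul_apply, LinearMap.sum_apply]
  rfl

theorem natCast_add_one_smul_sym_succ (n : ℕ) (f : MvPolynomial ι ℂ) :
    ((n : ℂ) + 1) • R.sym (n + 1) f = ∑ i, R.vec (B i) * R.sym n (pderiv i f) := by
  rw [sym_succ, smul_inv_smul₀ (Nat.cast_add_one_ne_zero n)]

theorem sym_mem_fil (n : ℕ) : ∀ f, R.sym n f ∈ R.fil (n + 1) := by
  induction n with
  | zero =>
    intro f
    have h : R.sym 0 f = R.grp (algebraMap ℂ _ (coeff 0 f)) := by
      rw [AlgHom.commutes]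
      rfl
    rw [h]
    exact R.grp_mem_fil _ _
  | succ n ih =>
    intro f
    rw [sym_succ]
    exact Submodule.smul_mem _ _
      (Submodule.sum_mem _ fun i _ => R.vec_mul_mem_fil (ih _) _)

theorem natCast_add_one_smul_sym_linForm_mul (n : ℕ) (v : V) (f : MvPolynomial ι ℂ) :
    ((n : ℂ) + 1) • R.sym (n + 1) (linForm B v * f) = R.vec v * R.sym n f +
      ∑ i, R.vec (B i) * R.sym n (linForm B v * pderiv i f) := by
  rw [natCast_add_one_smul_sym_succ]
  simp only [Derivation.leibniz, pderiv_linForm, smul_eq_mul, map_add, mul_add,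
    Finset.sum_add_distrib]
  rw [add_comm]
  refine congrArg (· + _) ?_
  rw [← sum_repr_smul_apply B R.vec v, Finset.sum_mul]
  refine Finset.sum_congr rfl fun i _ => ?_
  rw [mul_comm f, ← smul_eq_C_mul, map_smul, smul_mul_assoc, mul_smul_comm]

/-- Up to lower order terms, symmetrization is multiplicative. -/
theorem vec_mul_sym_sub (n : ℕ) : ∀ f : MvPolynomial ι ℂ, f.IsHomogeneous n → ∀ v,
    R.vec v * R.sym n f - R.sym (n + 1) (linForm B v * f) ∈ R.fil (n + 1) := by
  induction n with
  | zero =>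
    intro f hf v
    have h := R.natCast_add_one_smul_sym_linForm_mul 0 v f
    simp only [IsHomogeneous.pderiv_eq_zero hf, mul_zero, map_zero, Finset.sum_const_zero,
      add_zero, Nat.cast_zero, zero_add, one_smul] at h
    rw [zero_add, h, sub_self]
    exact Submodule.zero_mem _
  | succ n ih =>
    intro f hf v
    have hn : ((n + 1 : ℕ) : ℂ) + 1 ≠ 0 := Nat.cast_add_one_ne_zero (n + 1)
    have hd := isHomogeneous_of_succ_pderiv hf
    refine (Submodule.smul_mem_iff _ hn).1 ?_
    have h1 := R.natCast_add_one_smul_sym_linForm_mul (n + 1) v f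
    have h2 : R.vec v * ∑ i, R.vec (B i) * R.sym n (pderiv i f) =
        ((n : ℂ) + 1) • (R.vec v * R.sym (n + 1) f) := by
      rw [← natCast_add_one_smul_sym_succ, mul_smul_comm]
    have h3 : ∀ i, R.vec v * (R.vec (B i) * R.sym n (pderiv i f)) =
        R.vec (B i) * (R.vec v * R.sym n (pderiv i f)) +
          R.grp (κ v (B i)) * R.sym n (pderiv i f) := by
      intro i
      rw [← R.vec_mul_vec]
      noncomm_ring
    have h4 : ((((n + 1 : ℕ) : ℂ) + 1) • (R.vec v * R.sym (n + 1) f -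
        R.sym (n + 1 + 1) (linForm B v * f))) =
        ∑ i, (R.vec (B i) * (R.vec v * R.sym n (pderiv i f) -
          R.sym (n + 1) (linForm B v * pderiv i f)) +
          R.grp (κ v (B i)) * R.sym n (pderiv i f)) := by
      simp only [mul_sub, sub_add_eq_add_sub, ← h3]
      rw [Finset.sum_sub_distrib, ← Finset.mul_sum, h2, smul_sub, h1]
      push_cast
      module
    rw [h4]
    refine Submodule.sum_mem _ fun i _ => Submodule.add_mem _ ?_ ?_
    · exact R.vec_mul_mem_fil (ih _ (hd i) v) _
    · exact R.fil_le_succ _ (R.grp_mul_mem_fil _ _ (R.sym_mem_fil _ _) _)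

variable [Fintype G]

/-- The element of `A` with symbol `∑ F_g g`, for `F_g` homogeneous of degree `n`. -/
def lift (n : ℕ) (F : G → MvPolynomial ι ℂ) : A :=
  ∑ g, R.sym n (F g) * R.grp (MonoidAlgebra.of ℂ G g)

/-- Every element of `fil (n + 1)` has a symbol of degree `n`. -/
theorem exists_sub_lift_mem_fil (n : ℕ) : ∀ a ∈ R.fil (n + 1),
    ∃ F : G → MvPolynomial ι ℂ, (∀ g, (F g).IsHomogeneous n) ∧ a - R.lift n F ∈ R.fil n := by
  induction n with
  | zero =>
    intro a ha
    obtain ⟨x, rfl⟩ : ∃ x, R.grp x = a := by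
      refine R.fil_succ_le (W := LinearMap.range R.grp.toLinearMap) (fun x => ⟨x, rfl⟩)
        (fun v b hb => ?_) ha
      rw [(Submodule.mem_bot ℂ).1 hb, mul_zero]
      exact Submodule.zero_mem _
    refine ⟨fun g => C (x.coeff g), fun g => isHomogeneous_C _ _, ?_⟩
    convert Submodule.zero_mem _
    rw [sub_eq_zero, lift]
    simp only [sym_zero_C, ← Algebra.smul_def, ← map_smul, ← map_sum]
    congr 1
    classical
    ext g
    simp
  | succ n ih =>
    intro a ha
    let W : Submodule ℂ A :=
      { carrier := {a | ∃ F : G → MvPolynomial ι ℂ, (∀ g, (F g).IsHomogeneous (n + 1)) ∧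
          a - R.lift (n + 1) F ∈ R.fil (n + 1)}
        zero_mem' := ⟨0, fun g => isHomogeneous_zero _ _ _, by simp [lift]⟩
        add_mem' := by
          rintro a b ⟨F, hF, ha⟩ ⟨F', hF', hb⟩
          refine ⟨F + F', fun g => (hF g).add (hF' g), ?_⟩
          convert Submodule.add_mem _ ha hb using 1
          simp only [lift, Pi.add_apply, map_add, add_mul, Finset.sum_add_distrib]
          abel
        smul_mem' := by
          rintro r a ⟨F, hF, ha⟩
          refine ⟨r • F, fun g => Submodule.smul_mem (homogeneousSubmodule ι ℂ _) r (hF g), ?_⟩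
          convert Submodule.smul_mem _ r ha using 1
          simp only [lift, Pi.smul_apply, map_smul, smul_mul_assoc, Finset.smul_sum, smul_sub] }
    refine R.fil_succ_le (W := W) (fun x => ?_) (fun v b hb => ?_) ha
    · refine ⟨0, fun g => isHomogeneous_zero _ _ _, ?_⟩
      simpa [lift] using R.grp_mem_fil n x
    · obtain ⟨F, hF, hb⟩ := ih b hb
      refine ⟨fun g => linForm B v * F g, fun g => ?_, ?_⟩
      · rw [add_comm n 1]
        exact (linForm_isHomogeneous B v).mul (hF g)
      · have h1 := R.vec_mul_mem_fil hb v
        have h2 : ∑ g : G, (R.vec v * R.sym n (F g) - R.sym (n + 1) (linForm B v * F g)) *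
            R.grp (MonoidAlgebra.of ℂ G g) ∈ R.fil (n + 1) :=
          Submodule.sum_mem _ fun g _ =>
            R.mul_grp_mem_fil _ _ (R.vec_mul_sym_sub n _ (hF g) v) _
        convert Submodule.add_mem _ h1 h2 using 1
        simp only [lift, sub_mul, Finset.sum_sub_distrib, mul_sub, Finset.mul_sum, mul_assoc]
        abel

theorem act_mem_degLT (n : ℕ) : ∀ a ∈ R.fil n, ∀ m : ℤ, ∀ f ∈ degLT ι m,
    R.act a f ∈ degLT ι (m + n - 1) := by
  induction n with
  | zero =>
    intro a ha m f _
    rw [(Submodule.mem_bot ℂ).1 ha, map_zero]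
    exact Submodule.zero_mem _
  | succ n ih =>
    intro a ha m f hf
    refine R.fil_succ_le (W := (degLT ι (m + (n + 1 : ℕ) - 1)).comap
      (LinearMap.applyₗ f ∘ₗ R.act.toLinearMap)) (fun x => ?_) (fun v b hb => ?_) ha
    · change R.act (R.grp x) f ∈ degLT ι (m + (n + 1 : ℕ) - 1)
      rw [R.act_grp]
      exact degLT_mono (by omega) (groupAct_mem_degLT B x hf)
    · change R.act (R.vec v * b) f ∈ degLT ι (m + (n + 1 : ℕ) - 1)
      rw [map_mul, R.act_vec, Module.End.mul_apply]
      exact degLT_mono (by omega) (vecOp_mem_degLT B κ v (ih b hb m f hf))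

/-- The symmetrized element of a form `f` acts by multiplication by `f`, up to lower terms. -/
theorem act_sym_sub_mem_degLT (n : ℕ) : ∀ f : MvPolynomial ι ℂ, f.IsHomogeneous n →
    ∀ m : ℤ, ∀ u ∈ degLT ι m, R.act (R.sym n f) u - f * u ∈ degLT ι (m + n - 1) := by
  induction n with
  | zero =>
    intro f hf m u _
    rw [← totalDegree_zero_iff_isHomogeneous, totalDegree_eq_zero_iff_eq_C] at hf
    rw [hf, sym_zero_C, AlgHom.commutes, Module.algebraMap_end_apply, smul_eq_C_mul, sub_self]
    exact Submodule.zero_mem _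
  | succ n ih =>
    intro f hf m u hu
    have hn : (n : ℂ) + 1 ≠ 0 := Nat.cast_add_one_ne_zero n
    have hd := isHomogeneous_of_succ_pderiv hf
    refine (Submodule.smul_mem_iff _ hn).1 ?_
    have h1 : ((n : ℂ) + 1) • (R.act (R.sym (n + 1) f) u - f * u) =
        ∑ i, (vecOp B κ (B i) (R.act (R.sym n (pderiv i f)) u - pderiv i f * u) +
          lowerOp B κ (B i) (pderiv i f * u)) := by
      have h2 : ((n : ℂ) + 1) • (f * u) = ∑ i, linForm B (B i) * (pderiv i f * u) := by
        have := sum_linForm_mul_pderiv B hf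
        push_cast at this
        rw [← smul_mul_assoc, ← this, Finset.sum_mul]
        simp only [mul_assoc]
      rw [smul_sub, h2, ← LinearMap.smul_apply, ← map_smul, natCast_add_one_smul_sym_succ, map_sum,
        LinearMap.sum_apply, ← Finset.sum_sub_distrib]
      refine Finset.sum_congr rfl fun i _ => ?_
      rw [map_mul, R.act_vec, Module.End.mul_apply, map_sub, vecOp_apply B κ _ (_ * _)]
      abel
    rw [h1]
    refine Submodule.sum_mem _ fun i _ => Submodule.add_mem _ ?_ ?_
    · exact degLT_mono (by push_cast; omega) (vecOp_mem_degLT B κ _ (ih _ (hd i) m u hu))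
    · refine degLT_mono (m := m + n - 1) (by push_cast; omega) (lowerOp_mem_degLT B κ _ ?_)
      exact mul_mem_degLT (IsHomogeneous.mem_degLT (m := n + 1) (hd i) (by omega)) hu (by omega)

theorem act_sym_one (halt : IsSkew κ) (n : ℕ) :
    ∀ f : MvPolynomial ι ℂ, f.IsHomogeneous n → R.act (R.sym n f) 1 = f := by
  induction n with
  | zero =>
    intro f hf
    rw [← totalDegree_zero_iff_isHomogeneous, totalDegree_eq_zero_iff_eq_C] at hf
    rw [hf, sym_zero_C, AlgHom.commutes, Module.algebraMap_end_apply, smul_eq_C_mul, mul_one]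
  | succ n ih =>
    intro f hf
    have hd := isHomogeneous_of_succ_pderiv hf
    have h := sum_vecOp_pderiv B κ halt hf
    push_cast at h
    refine smul_right_injective _ (Nat.cast_add_one_ne_zero (R := ℂ) n) ?_
    simp only
    rw [← h, ← LinearMap.smul_apply, ← map_smul, natCast_add_one_smul_sym_succ, map_sum,
      LinearMap.sum_apply]
    refine Finset.sum_congr rfl fun i _ => ?_
    rw [map_mul, R.act_vec, Module.End.mul_apply, ih _ (hd i)]

/-- The element of the algebra lifting `∑ F_g g` has this as its symbol on polynomials. -/
theorem act_lift_sub_mem_degLT {n : ℕ} {F : G → MvPolynomial ι ℂ}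
    (hF : ∀ g, (F g).IsHomogeneous n) {m : ℤ} {f : MvPolynomial ι ℂ} (hf : f ∈ degLT ι m) :
    R.act (R.lift n F) f - ∑ g : G, F g * polyAct B (g : V ≃ₗ[ℂ] V) f ∈
      degLT ι (m + n - 1) := by
  rw [lift, map_sum, LinearMap.sum_apply, ← Finset.sum_sub_distrib]
  refine Submodule.sum_mem _ fun g _ => ?_
  rw [map_mul, Module.End.mul_apply, R.act_grp, MonoidAlgebra.of_apply, groupAct_single, one_smul]
  exact R.act_sym_sub_mem_degLT n _ (hF g) m _ (polyAct_mem_degLT B _ hf)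

theorem sum_mul_polyAct_isHomogeneous {n k : ℕ} {F : G → MvPolynomial ι ℂ}
    (hF : ∀ g, (F g).IsHomogeneous n) {f : MvPolynomial ι ℂ} (hf : f.IsHomogeneous k) :
    (∑ g : G, F g * polyAct B (g : V ≃ₗ[ℂ] V) f).IsHomogeneous (n + k) :=
  IsHomogeneous.sum _ _ _ fun g _ => (hF g).mul (polyAct_isHomogeneous B _ hf)

/-- The action of `A` on polynomials is faithful. -/
theorem eq_zero_of_act_eq_zero {a : A} (ha : R.act a = 0) : a = 0 := by
  have key : ∀ n, ∀ a ∈ R.fil n, R.act a = 0 → a = 0 := by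
    intro n
    induction n with
    | zero => exact fun a ha _ => (Submodule.mem_bot ℂ).1 ha
    | succ n ih =>
      intro a ha h0
      obtain ⟨F, hF, hb⟩ := R.exists_sub_lift_mem_fil n a ha
      have hsum : ∀ f, ∑ g : G, F g * polyAct B (g : V ≃ₗ[ℂ] V) f = 0 := by
        have : (∑ g : G, LinearMap.mulLeft ℂ (F g) ∘ₗ (polyAct B (g : V ≃ₗ[ℂ] V)).toLinearMap) =
            0 := by
          refine linearMap_ext_isHomogeneous fun k f hf => ?_
          rw [LinearMap.sum_apply]
          change ∑ g : G, F g * polyAct B (g : V ≃ₗ[ℂ] V) f = 0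
          have hf' : f ∈ degLT ι (k + 1) := IsHomogeneous.mem_degLT hf (by omega)
          have h1 := R.act_lift_sub_mem_degLT hF hf'
          have h2 := R.act_mem_degLT n _ hb _ f hf'
          rw [map_sub, h0, zero_sub, LinearMap.neg_apply] at h2
          have h3 := Submodule.add_mem _ h2 h1
          rw [neg_add_eq_sub, sub_sub_cancel_left, Submodule.neg_mem_iff] at h3
          exact IsHomogeneous.eq_zero_of_mem_degLT (sum_mul_polyAct_isHomogeneous hF hf) h3
            (by push_cast; omega)
        intro f
        have h := congrArg (fun P => P f) this
        rw [LinearMap.sum_apply] at h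
        exact h
      have hF0 := eq_zero_of_sum_mul_polyAct B hsum
      have : R.lift n F = 0 := by simp [lift, hF0]
      rw [this, sub_zero] at hb
      exact ih a hb h0
  obtain ⟨n, hn⟩ := R.exists_mem_fil a
  exact key n a hn ha

/-- Symmetrization of polynomials into `A`. -/
def tau : MvPolynomial ι ℂ →ₗ[ℂ] A := gradedMap R.sym

theorem tau_of_isHomogeneous {f : MvPolynomial ι ℂ} {n : ℕ} (hf : f.IsHomogeneous n) :
    R.tau f = R.sym n f := gradedMap_of_isHomogeneous _ hf

theorem act_tau_one (halt : IsSkew κ) (f : MvPolynomial ι ℂ) :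
    R.act (R.tau f) 1 = f := by
  refine mem_of_forall_isHomogeneous (W := LinearMap.eqLocus
    (LinearMap.applyₗ 1 ∘ₗ R.act.toLinearMap ∘ₗ R.tau) LinearMap.id) (fun n f hf => ?_) f
  change R.act (R.tau f) 1 = f
  rw [R.tau_of_isHomogeneous hf, R.act_sym_one halt n f hf]

theorem act_tau_sub_mem_degLT {m k : ℤ} {f u : MvPolynomial ι ℂ} (hf : f ∈ degLT ι m)
    (hu : u ∈ degLT ι k) : R.act (R.tau f) u - f * u ∈ degLT ι (m + k - 2) := by
  refine degLT_le (W := (degLT ι (m + k - 2)).comap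
    (LinearMap.applyₗ u ∘ₗ R.act.toLinearMap ∘ₗ R.tau - LinearMap.mulRight ℂ u))
    (fun n hn f hf => ?_) hf
  change R.act (R.tau f) u - f * u ∈ degLT ι (m + k - 2)
  rw [R.tau_of_isHomogeneous hf]
  exact degLT_mono (by omega) (R.act_sym_sub_mem_degLT n f hf k u hu)

theorem act_tau_mem_degLT {m k : ℤ} {f u : MvPolynomial ι ℂ} (hf : f ∈ degLT ι m)
    (hu : u ∈ degLT ι k) : R.act (R.tau f) u ∈ degLT ι (m + k - 1) := by
  have h := Submodule.add_mem _ (degLT_mono (by omega) (R.act_tau_sub_mem_degLT hf hu))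
    (mul_mem_degLT (k := m + k - 1) hf hu (by omega))
  rwa [sub_add_cancel] at h

theorem act_groupIdem {u : MvPolynomial ι ℂ}
    (hu : ∀ g : G, polyAct B (g : V ≃ₗ[ℂ] V) u = u) : R.act (R.grp (groupIdem G)) u = u := by
  have hc : (Fintype.card G : ℂ) ≠ 0 := Nat.cast_ne_zero.2 Fintype.card_ne_zero
  rw [R.act_grp, groupIdem, map_smul, map_sum, LinearMap.smul_apply, LinearMap.sum_apply]
  simp only [MonoidAlgebra.of_apply, groupAct_single, one_smul, hu, Finset.sum_const,
    Finset.card_univ]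
  rw [← Nat.cast_smul_eq_nsmul ℂ, smul_smul, inv_mul_cancel₀ hc, one_smul]

theorem polyAct_one_eq (g : G) :
    polyAct B (g : V ≃ₗ[ℂ] V) (1 : MvPolynomial ι ℂ) = 1 := map_one _

/-- `A e` is the image of the polynomials under symmetrization. -/
theorem mul_groupIdem_eq (halt : IsSkew κ) (a : A) :
    a * R.grp (groupIdem G) = R.tau (R.act a 1) * R.grp (groupIdem G) := by
  have key : ∀ n, ∀ a ∈ R.fil n, ∃ f, a * R.grp (groupIdem G) = R.tau f * R.grp (groupIdem G) := by
    intro n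
    induction n with
    | zero =>
      intro a ha
      exact ⟨0, by rw [(Submodule.mem_bot ℂ).1 ha, map_zero]⟩
    | succ n ih =>
      intro a ha
      obtain ⟨F, hF, hb⟩ := R.exists_sub_lift_mem_fil n a ha
      obtain ⟨f, hf⟩ := ih _ hb
      refine ⟨f + ∑ g, F g, ?_⟩
      have h1 : R.lift n F * R.grp (groupIdem G) =
          R.tau (∑ g, F g) * R.grp (groupIdem G) := by
        rw [lift, map_sum, Finset.sum_mul, Finset.sum_mul]
        refine Finset.sum_congr rfl fun g _ => ?_
        rw [mul_assoc, ← map_mul, of_mul_groupIdem, R.tau_of_isHomogeneous (hF g)]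
      rw [map_add, add_mul, ← hf, ← h1, sub_mul, sub_add_cancel]
  obtain ⟨n, hn⟩ := R.exists_mem_fil a
  obtain ⟨f, hf⟩ := key n a hn
  have h := congrArg (fun b => R.act b 1) hf
  simp only [map_mul, Module.End.mul_apply, R.act_groupIdem polyAct_one_eq,
    R.act_tau_one halt] at h
  rw [h, hf]

/-- For invariant `u`, the operators `f ↦ τ(f) u` commute with the action of `A`. -/
theorem act_act_tau (halt : IsSkew κ) {u : MvPolynomial ι ℂ}
    (hu : ∀ g : G, polyAct B (g : V ≃ₗ[ℂ] V) u = u) (a : A) (f : MvPolynomial ι ℂ) :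
    R.act a (R.act (R.tau f) u) = R.act (R.tau (R.act a f)) u := by
  have h := R.mul_groupIdem_eq halt (a * R.tau f)
  rw [map_mul, Module.End.mul_apply, R.act_tau_one halt] at h
  have h2 := congrArg (fun b => R.act b u) h
  simpa only [map_mul, Module.End.mul_apply, R.act_groupIdem hu] using h2

end PolynomialRep

end Model

/-! ### Endomorphisms of `Ae` over `eAe` -/

section Coefficients

variable {ι : Type*}

/-- The elementary symmetric functions of elements of degree at most one have the expected degree. -/
theorem coeff_prod_X_sub_C_mem_degLT {α : Type*} (s : Finset α) (ℓ : α → MvPolynomial ι ℂ)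
    (hℓ : ∀ x, ℓ x ∈ degLT ι 2) : ∀ k : ℕ,
    (∏ x ∈ s, (Polynomial.X - Polynomial.C (ℓ x))).coeff k ∈ degLT ι (s.card - k + 1) := by
  classical
  induction s using Finset.induction_on with
  | empty =>
    intro k
    rw [Finset.prod_empty, Polynomial.coeff_one]
    split_ifs with h
    · exact IsHomogeneous.mem_degLT (isHomogeneous_one ι ℂ) (by simp [h])
    · exact Submodule.zero_mem _
  | insert x s hx ih =>
    intro k
    rw [Finset.prod_insert hx, Finset.card_insert_of_notMem hx, sub_mul, Polynomial.coeff_sub,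
      Polynomial.coeff_C_mul]
    push_cast
    refine Submodule.sub_mem _ ?_ (mul_mem_degLT (hℓ x) (ih k) (by omega))
    obtain _ | k := k
    · rw [Polynomial.coeff_X_mul_zero]
      exact Submodule.zero_mem _
    · rw [Polynomial.coeff_X_mul]
      exact degLT_mono (by push_cast; omega) (ih k)

end Coefficients

section FiniteOrder

variable {V : Type*} [AddCommGroup V] [Module ℂ V] {ι : Type*} [Fintype ι]
  (B : Module.Basis ι ℂ V) (G : Subgroup (V ≃ₗ[ℂ] V)) [Fintype G]

/-- The `|G|`-th power of each variable is a combination of lower powers with invariant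
coefficients of complementary degree. -/
theorem X_pow_card_eq (i : ι) : ∃ u : ℕ → MvPolynomial ι ℂ,
    (∀ k, ∀ g : G, polyAct B (g : V ≃ₗ[ℂ] V) (u k) = u k) ∧
    (∀ k : ℕ, u k ∈ degLT ι (Fintype.card G - k + 1)) ∧
    (X i : MvPolynomial ι ℂ) ^ Fintype.card G =
      ∑ k ∈ Finset.range (Fintype.card G), u k * X i ^ k := by
  let P : Polynomial (MvPolynomial ι ℂ) :=
    ∏ g : G, (Polynomial.X - Polynomial.C (linForm B ((g : V ≃ₗ[ℂ] V) (B i))))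
  have hP : ∀ γ : G, P.map (polyAct B (γ : V ≃ₗ[ℂ] V)).toRingHom = P := by
    intro γ
    rw [Polynomial.map_prod]
    refine Fintype.prod_equiv (Equiv.mulLeft γ) _ _ fun g => ?_
    rw [Polynomial.map_sub, Polynomial.map_X, Polynomial.map_C]
    exact congrArg (fun q => Polynomial.X - Polynomial.C q) (polyAct_linForm B _ _)
  have hmonic : P.Monic := Polynomial.monic_prod_X_sub_C _ _
  have hdeg : P.natDegree = Fintype.card G := by
    rw [Polynomial.natDegree_prod_of_monic _ _ fun g _ => Polynomial.monic_X_sub_C _]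
    simp
  have heval : P.eval (X i) = 0 := by
    rw [Polynomial.eval_prod]
    refine Finset.prod_eq_zero (Finset.mem_univ (1 : G)) ?_
    rw [Polynomial.eval_sub, Polynomial.eval_X, Polynomial.eval_C]
    exact sub_eq_zero.2 (linForm_basis B i).symm
  refine ⟨fun k => - P.coeff k, fun k g => ?_, fun k => ?_, ?_⟩
  · have := congrArg (fun q => q.coeff k) (hP g)
    simp only [Polynomial.coeff_map] at this
    rw [map_neg]
    exact congrArg _ this
  · exact Submodule.neg_mem _
      (coeff_prod_X_sub_C_mem_degLT Finset.univ _ (fun g => linForm_mem_degLT B _) k)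
  · rw [Polynomial.eval_eq_sum_range, hdeg, Finset.sum_range_succ, ← hdeg,
      hmonic.coeff_natDegree, one_mul, hdeg] at heval
    simp only [neg_mul, Finset.sum_neg_distrib]
    exact eq_neg_of_add_eq_zero_right heval

end FiniteOrder

section EndomorphismTheorem

variable {V : Type*} [AddCommGroup V] [Module ℂ V] {ι : Type*} [Fintype ι]
  {B : Module.Basis ι ℂ V} {G : Subgroup (V ≃ₗ[ℂ] V)} [Fintype G]
  {κ : V →ₗ[ℂ] V →ₗ[ℂ] MonoidAlgebra ℂ G}
  {A : Type*} [Ring A] [Algebra ℂ A] (R : PolynomialRep B κ A)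

namespace PolynomialRep

/-- A linear endomorphism of the polynomials commutes with the right action `f ↦ τ(f) u` of the
invariants `u`. -/
def IsCornerLinear (φ : MvPolynomial ι ℂ →ₗ[ℂ] MvPolynomial ι ℂ) : Prop :=
  ∀ u : MvPolynomial ι ℂ, (∀ g : G, polyAct B (g : V ≃ₗ[ℂ] V) u = u) →
    ∀ f, φ (R.act (R.tau f) u) = R.act (R.tau (φ f)) u

/-- `φ` raises degrees by at most `d`. -/
def HasOrderLE (φ : MvPolynomial ι ℂ →ₗ[ℂ] MvPolynomial ι ℂ) (d : ℤ) : Prop :=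
  ∀ m : ℤ, ∀ f ∈ degLT ι m, φ f ∈ degLT ι (m + d)

variable {R}

theorem hasOrderLE_of_isHomogeneous {φ : MvPolynomial ι ℂ →ₗ[ℂ] MvPolynomial ι ℂ} {d : ℤ}
    (h : ∀ (n : ℕ) (f : MvPolynomial ι ℂ), f.IsHomogeneous n → φ f ∈ degLT ι (n + 1 + d)) :
    HasOrderLE φ d := by
  intro m f hf
  refine degLT_le (W := (degLT ι (m + d)).comap φ) (fun n hn f hf => ?_) hf
  exact degLT_mono (by omega) (h n f hf)

/-- Endomorphisms over the corner have finite order, because the polynomials are finite over the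
invariants. -/
theorem IsCornerLinear.exists_hasOrderLE {φ : MvPolynomial ι ℂ →ₗ[ℂ] MvPolynomial ι ℂ}
    (hφ : IsCornerLinear R φ) : ∃ D : ℕ, HasOrderLE φ D := by
  classical
  let N := Fintype.card G
  -- Monomials in which no exponent reaches `N` have bounded degree.
  let M₀ := N * Fintype.card ι
  have hfin : {a : ι →₀ ℕ | a.degree ≤ M₀}.Finite := Finsupp.finite_of_degree_le M₀
  let D : ℕ := hfin.toFinset.sup fun a => (φ (monomial a 1)).totalDegree
  have key : ∀ M : ℕ, ∀ f ∈ degLT ι M, φ f ∈ degLT ι (M + D) := by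
    intro M
    induction M using Nat.strong_induction_on with | _ M ih
    obtain _ | M := M
    · intro f hf
      rw [eq_zero_of_mem_degLT (by simp) hf, map_zero]
      exact Submodule.zero_mem _
    · push_cast
      have hmono : ∀ a : ι →₀ ℕ, a.degree ≤ M → φ (monomial a 1) ∈ degLT ι (M + 1 + D) := by
        intro a ha
        by_cases hsmall : a.degree ≤ M₀
        · have h1 : (φ (monomial a 1)).totalDegree ≤ D :=
            Finset.le_sup (f := fun a => (φ (monomial a 1)).totalDegree)
              (hfin.mem_toFinset.2 hsmall)
          exact degLT_mono (by omega) (exists_mem_degLT _)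
        · obtain ⟨i, hi⟩ : ∃ i, N ≤ a i := by
            by_contra! hlt
            refine hsmall ?_
            rw [Finsupp.degree_eq_sum]
            calc ∑ i, a i ≤ ∑ _i : ι, N := Finset.sum_le_sum fun i _ => (hlt i).le
              _ = M₀ := by simp [M₀, mul_comm]
          obtain ⟨u, hu, hud, hX⟩ := X_pow_card_eq B G i
          let a' := a - Finsupp.single i N
          have ha' : a = a' + Finsupp.single i N := by
            refine (tsub_add_cancel_of_le ?_).symm
            rwa [Finsupp.single_le_iff]
          have hdeg : a.degree = a'.degree + N := by
            conv_lhs => rw [ha']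
            simp
          have hmon : (monomial a 1 : MvPolynomial ι ℂ) =
              ∑ k ∈ Finset.range N, monomial a' 1 * X i ^ k * u k := by
            have : (monomial a 1 : MvPolynomial ι ℂ) = monomial a' 1 * X i ^ N := by
              rw [X_pow_eq_monomial, monomial_mul, ← ha', one_mul]
            rw [this, hX, Finset.mul_sum]
            exact Finset.sum_congr rfl fun k _ => by ring
          rw [hmon, map_sum]
          refine Submodule.sum_mem _ fun k hk => ?_
          rw [Finset.mem_range] at hk
          have hp : (monomial a' 1 * X i ^ k : MvPolynomial ι ℂ) ∈
              degLT ι ((a'.degree + k + 1 : ℕ) : ℤ) := by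
            refine IsHomogeneous.mem_degLT (n := a'.degree + k) ?_ (by push_cast; omega)
            exact (isHomogeneous_monomial _ rfl).mul (isHomogeneous_X_pow i k)
          have h1 := R.act_tau_sub_mem_degLT hp (hud k)
          have h2 := ih M (by omega) _ (degLT_mono (by push_cast; omega) h1)
          have h3 := ih _ (by omega) _ hp
          have h4 := R.act_tau_mem_degLT h3 (hud k)
          rw [map_sub, hφ _ (hu k)] at h2
          have h5 := Submodule.sub_mem _ (degLT_mono (m' := M + 1 + D) (by push_cast; omega) h4)
            (degLT_mono (m' := M + 1 + D) (by omega) h2)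
          rwa [sub_sub_cancel] at h5
      intro f hf
      rw [f.as_sum, map_sum]
      refine Submodule.sum_mem _ fun a ha => ?_
      have : (monomial a (coeff a f)) = coeff a f • (monomial a 1 : MvPolynomial ι ℂ) := by
        simp [smul_monomial]
      rw [this, map_smul]
      have hlt := hf a (mem_support_iff.1 ha)
      exact Submodule.smul_mem _ _ (hmono a (by omega))
  refine ⟨D, hasOrderLE_of_isHomogeneous fun n f hf => ?_⟩
  have := key (n + 1) f (IsHomogeneous.mem_degLT hf (by push_cast; omega))
  exact_mod_cast this

variable (φ : MvPolynomial ι ℂ →ₗ[ℂ] MvPolynomial ι ℂ) (d : ℤ)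

/-- The symbol of order `d` of an endomorphism: the part that raises degrees by exactly `d`. -/
def symbol : MvPolynomial ι ℂ →ₗ[ℂ] MvPolynomial ι ℂ :=
  gradedMap fun n => if 0 ≤ (n : ℤ) + d then homogeneousComponent ((n : ℤ) + d).toNat ∘ₗ φ else 0

variable {φ d}

theorem symbol_of_nonneg {f : MvPolynomial ι ℂ} {n k : ℕ} (hf : f.IsHomogeneous n)
    (h : (n : ℤ) + d = k) : symbol φ d f = homogeneousComponent k (φ f) := by
  rw [symbol, gradedMap_of_isHomogeneous _ hf, if_pos (by omega), h]
  rfl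

theorem symbol_of_neg {f : MvPolynomial ι ℂ} {n : ℕ} (hf : f.IsHomogeneous n)
    (h : (n : ℤ) + d < 0) : symbol φ d f = 0 := by
  rw [symbol, gradedMap_of_isHomogeneous _ hf, if_neg (by omega)]
  rfl

theorem HasOrderLE.sub_symbol_mem_degLT (hφ : HasOrderLE φ d) {f : MvPolynomial ι ℂ} {n : ℕ}
    (hf : f.IsHomogeneous n) : φ f - symbol φ d f ∈ degLT ι (n + d) := by
  have h1 : φ f ∈ degLT ι (n + d + 1) :=
    degLT_mono (by omega) (hφ (n + 1) f (IsHomogeneous.mem_degLT hf (by omega)))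
  by_cases h : 0 ≤ (n : ℤ) + d
  · obtain ⟨k, hk⟩ := Int.eq_ofNat_of_zero_le h
    rw [hk] at h1 ⊢
    rw [symbol_of_nonneg hf hk]
    exact sub_homogeneousComponent_mem_degLT h1
  · rw [eq_zero_of_mem_degLT (by omega) h1, symbol_of_neg hf (by omega), sub_zero]
    exact Submodule.zero_mem _

/-- The symbol of a corner-linear endomorphism is linear over the invariants. -/
theorem IsCornerLinear.symbol_mul (hφ : IsCornerLinear R φ) (hd : HasOrderLE φ d)
    {u : MvPolynomial ι ℂ} (hu : ∀ g : G, polyAct B (g : V ≃ₗ[ℂ] V) u = u)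
    (f : MvPolynomial ι ℂ) : symbol φ d (u * f) = u * symbol φ d f := by
  -- It suffices to treat homogeneous `f` and the homogeneous components of `u`.
  refine mem_of_forall_isHomogeneous (W := LinearMap.eqLocus
    (symbol φ d ∘ₗ LinearMap.mulLeft ℂ u) (LinearMap.mulLeft ℂ u ∘ₗ symbol φ d))
    (fun n f hf => ?_) f
  change symbol φ d (u * f) = u * symbol φ d f
  rw [← sum_homogeneousComponent u, Finset.sum_mul, Finset.sum_mul, map_sum]
  refine Finset.sum_congr rfl fun k _ => ?_
  have hw : ∀ g : G, polyAct B (g : V ≃ₗ[ℂ] V) (homogeneousComponent k u) =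
      homogeneousComponent k u := fun g => by rw [← homogeneousComponent_polyAct, hu]
  have hwk := homogeneousComponent_isHomogeneous k u
  generalize homogeneousComponent k u = w at hw hwk
  have hwk' : w ∈ degLT ι (k + 1) := IsHomogeneous.mem_degLT hwk (by omega)
  have hf' : f ∈ degLT ι (n + 1) := IsHomogeneous.mem_degLT hf (by omega)
  have hwf : (w * f).IsHomogeneous (k + n) := hwk.mul hf
  have e1 := hd.sub_symbol_mem_degLT hwf
  have e2 := hd _ _ (R.act_tau_sub_mem_degLT hf' hwk')
  rw [map_sub, hφ w hw] at e2
  have e3 := R.act_tau_sub_mem_degLT (hd _ _ hf') hwk'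
  have e4 := mul_mem_degLT (k := n + d + k) (hd.sub_symbol_mem_degLT hf) hwk' (by omega)
  have e5 : symbol φ d (w * f) - w * symbol φ d f ∈ degLT ι (n + d + k) := by
    have h1 := degLT_mono (m' := n + d + k) (by push_cast; omega) e1
    have h2 := degLT_mono (m' := n + d + k) (by omega) e2
    have h3 := degLT_mono (m' := n + d + k) (by omega) e3
    have := Submodule.add_mem _ (Submodule.sub_mem _ (Submodule.sub_mem _ h3 h2) h1) e4
    convert this using 1
    rw [mul_comm w f]
    ring
  refine sub_eq_zero.1 ?_
  by_cases h : 0 ≤ (n : ℤ) + d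
  · obtain ⟨j, hj⟩ := Int.eq_ofNat_of_zero_le h
    refine IsHomogeneous.eq_zero_of_mem_degLT (n := k + j) (IsHomogeneous.sub ?_ ?_) e5
      (by push_cast; omega)
    · rw [symbol_of_nonneg (k := k + j) hwf (by push_cast; omega)]
      exact homogeneousComponent_isHomogeneous _ _
    · rw [symbol_of_nonneg hf hj]
      exact hwk.mul (homogeneousComponent_isHomogeneous _ _)
  · rw [symbol_of_neg hf (by omega), mul_zero, sub_zero] at e5 ⊢
    by_cases h' : 0 ≤ ((k + n : ℕ) : ℤ) + d
    · obtain ⟨j, hj⟩ := Int.eq_ofNat_of_zero_le h'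
      rw [symbol_of_nonneg hwf hj] at e5 ⊢
      exact IsHomogeneous.eq_zero_of_mem_degLT (homogeneousComponent_isHomogeneous _ _) e5
        (by push_cast at hj; omega)
    · exact symbol_of_neg hwf (by omega)

/-- The symbol of a corner-linear endomorphism is the symbol of an element of `A`. -/
theorem IsCornerLinear.symbol_eq (hG : NoReflections G) (hφ : IsCornerLinear R φ)
    (hd : HasOrderLE φ d) :
    (d < 0 → symbol φ d = 0) ∧ ∀ n : ℕ, d = n → ∃ F : G → MvPolynomial ι ℂ,
      (∀ g, (F g).IsHomogeneous n) ∧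
        ∀ f, symbol φ d f = ∑ g : G, F g * polyAct B (g : V ≃ₗ[ℂ] V) f := by
  obtain ⟨F, hF⟩ := hG.exists_eq_sum B (symbol φ d) fun u hu f => hφ.symbol_mul hd hu f
  have hcomp : ∀ {f : MvPolynomial ι ℂ} {n k : ℕ}, f.IsHomogeneous n → (n : ℤ) + d = k →
      symbol φ d f = ∑ g : G, if n ≤ k then
        homogeneousComponent (k - n) (F g) * polyAct B (g : V ≃ₗ[ℂ] V) f else 0 := by
    intro f n k hf hk
    have h1 : homogeneousComponent k (symbol φ d f) = symbol φ d f := by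
      rw [symbol_of_nonneg hf hk]
      exact homogeneousComponent_eq_self (homogeneousComponent_isHomogeneous _ _)
    rw [← h1, hF, map_sum]
    exact Finset.sum_congr rfl fun g _ =>
      homogeneousComponent_mul_of_isHomogeneous _ (polyAct_isHomogeneous B _ hf) k
  refine ⟨fun hneg => linearMap_ext_isHomogeneous fun n f hf => ?_, fun n hn =>
    ⟨fun g => homogeneousComponent n (F g), fun g => homogeneousComponent_isHomogeneous _ _,
      fun f => ?_⟩⟩
  · rw [LinearMap.zero_apply]
    by_cases h : 0 ≤ (n : ℤ) + d
    · obtain ⟨k, hk⟩ := Int.eq_ofNat_of_zero_le h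
      rw [hcomp hf hk]
      exact Finset.sum_eq_zero fun g _ => if_neg (by omega)
    · exact symbol_of_neg hf (by omega)
  · have : symbol φ d = ∑ g : G, LinearMap.mulLeft ℂ (homogeneousComponent n (F g)) ∘ₗ
        (polyAct B (g : V ≃ₗ[ℂ] V)).toLinearMap := by
      refine linearMap_ext_isHomogeneous fun j f hf => ?_
      rw [hcomp (k := j + n) hf (by push_cast; omega), LinearMap.sum_apply]
      refine Finset.sum_congr rfl fun g _ => ?_
      rw [if_pos (by omega), Nat.add_sub_cancel_left]
      rfl
    rw [this, LinearMap.sum_apply]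
    rfl

theorem IsCornerLinear.sub_act (halt : IsSkew κ) (hφ : IsCornerLinear R φ) (a : A) :
    IsCornerLinear R (φ - R.act a) := by
  intro u hu f
  rw [LinearMap.sub_apply, hφ u hu, R.act_act_tau halt hu, LinearMap.sub_apply, map_sub, map_sub,
    LinearMap.sub_apply]

theorem IsCornerLinear.hasOrderLE_of_neg (hG : NoReflections G) (hφ : IsCornerLinear R φ)
    (hd : HasOrderLE φ d) (hneg : d < 0) : HasOrderLE φ (d - 1) := by
  refine hasOrderLE_of_isHomogeneous fun n f hf => ?_
  have h := hd.sub_symbol_mem_degLT hf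
  rw [(hφ.symbol_eq hG hd).1 hneg, LinearMap.zero_apply, sub_zero] at h
  exact degLT_mono (by omega) h

/-- An endomorphism of negative order has order `≤ d` for all `d`, hence vanishes. -/
theorem IsCornerLinear.eq_zero_of_neg (hG : NoReflections G) (hφ : IsCornerLinear R φ)
    (hd : HasOrderLE φ (-1)) : φ = 0 := by
  have key : ∀ k : ℕ, HasOrderLE φ (-1 - k) := by
    intro k
    induction k with
    | zero => simpa using hd
    | succ k ih =>
      have := hφ.hasOrderLE_of_neg hG ih (by omega)
      push_cast
      rwa [← sub_sub]
  refine LinearMap.ext fun f => ?_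
  exact eq_zero_of_mem_degLT (by omega)
    (key f.totalDegree _ f (exists_mem_degLT f))

/-- An endomorphism of order `≤ n` can be corrected by an element of `A` to have order `< n`. -/
theorem IsCornerLinear.exists_sub_act_hasOrderLE (hG : NoReflections G) (hφ : IsCornerLinear R φ)
    {n : ℕ} (hd : HasOrderLE φ n) : ∃ a : A, HasOrderLE (φ - R.act a) (n - 1) := by
  obtain ⟨F, hF, hsym⟩ := (hφ.symbol_eq hG hd).2 n rfl
  refine ⟨R.lift n F, hasOrderLE_of_isHomogeneous fun k f hf => ?_⟩
  have h1 := hd.sub_symbol_mem_degLT hf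
  have h2 := R.act_lift_sub_mem_degLT hF (IsHomogeneous.mem_degLT (m := k + 1) hf (by omega))
  rw [← hsym] at h2
  have h3 := Submodule.sub_mem _ h1 (degLT_mono (m' := k + n) (by omega) h2)
  rw [sub_sub_sub_cancel_right] at h3
  exact degLT_mono (by omega) h3

theorem IsCornerLinear.exists_eq_act_of_hasOrderLE (halt : IsSkew κ)
    (hG : NoReflections G) (n : ℕ) : ∀ φ : MvPolynomial ι ℂ →ₗ[ℂ] MvPolynomial ι ℂ,
      IsCornerLinear R φ → HasOrderLE φ ((n : ℤ) - 1) → ∃ a : A, φ = R.act a := by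
  induction n with
  | zero =>
    intro φ hφ hd
    exact ⟨0, by rw [map_zero, hφ.eq_zero_of_neg hG (by simpa using hd)]⟩
  | succ n ih =>
    intro φ hφ hd
    push_cast at hd
    rw [add_sub_cancel_right] at hd
    obtain ⟨a, ha⟩ := hφ.exists_sub_act_hasOrderLE hG hd
    obtain ⟨b, hb⟩ := ih _ (hφ.sub_act halt a) ha
    exact ⟨b + a, by rw [map_add, ← hb, sub_add_cancel]⟩

/-- Every corner-linear endomorphism of the polynomials is the action of an element of `A`. -/
theorem IsCornerLinear.exists_eq_act (halt : IsSkew κ)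
    (hG : NoReflections G) {φ : MvPolynomial ι ℂ →ₗ[ℂ] MvPolynomial ι ℂ}
    (hφ : IsCornerLinear R φ) : ∃ a : A, φ = R.act a := by
  obtain ⟨D, hD⟩ := hφ.exists_hasOrderLE
  exact IsCornerLinear.exists_eq_act_of_hasOrderLE halt hG (D + 1) φ hφ (by simpa using hD)

/-- Left multiplication identifies `A` with the endomorphisms of the right `eAe`-module `Ae`. -/
theorem exists_algEquiv_end (halt : IsSkew κ) (hG : NoReflections G)
    {e : A} (he : IsIdempotentElem e) (hee : e = R.grp (groupIdem G)) :
    ∃ η : A ≃ₐ[ℂ] Module.End he.Cornerᵐᵒᵖ (leftIdeal e),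
      ∀ (a : A) (x : leftIdeal e), (η a x : A) = a * x := by
  have hact1 : R.act e 1 = 1 := by
    rw [hee]
    exact R.act_groupIdem polyAct_one_eq
  have htau : ∀ x : leftIdeal e, (x : A) = R.tau (R.act x 1) * e := by
    intro x
    obtain ⟨a, ha⟩ := mem_leftIdeal.1 x.2
    rw [← ha, map_mul, Module.End.mul_apply, hact1, hee]
    exact R.mul_groupIdem_eq halt a
  let mulEnd : A → Module.End he.Cornerᵐᵒᵖ (leftIdeal e) := fun a =>
    { toFun := fun x => ⟨a * x, (leftIdeal e).smul_mem a x.2⟩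
      map_add' := fun x y => Subtype.ext (mul_add a x y)
      map_smul' := fun y x => Subtype.ext (mul_assoc a x y.unop.1).symm }
  let ηhom : A →ₐ[ℂ] Module.End he.Cornerᵐᵒᵖ (leftIdeal e) :=
    { toFun := mulEnd
      map_one' := LinearMap.ext fun x => Subtype.ext (one_mul (x : A))
      map_mul' := fun a b => LinearMap.ext fun x => Subtype.ext (mul_assoc a b x)
      map_zero' := LinearMap.ext fun x => Subtype.ext (zero_mul (x : A))
      map_add' := fun a b => LinearMap.ext fun x => Subtype.ext (add_mul a b x)
      commutes' := fun r => LinearMap.ext fun x => Subtype.ext (Algebra.smul_def r (x : A)).symm }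
  have hinj : Function.Injective ηhom := by
    rw [injective_iff_map_eq_zero]
    intro a ha
    refine R.eq_zero_of_act_eq_zero (LinearMap.ext fun f => ?_)
    have h1 : a * (R.tau f * e) = 0 := congrArg Subtype.val
      (LinearMap.congr_fun ha ⟨R.tau f * e, mem_leftIdeal.2 ⟨_, rfl⟩⟩)
    have h2 := congrArg (fun b => R.act b 1) h1
    simpa only [map_mul, Module.End.mul_apply, hact1, R.act_tau_one halt, map_zero,
      LinearMap.zero_apply] using h2
  have hsurj : Function.Surjective ηhom := by
    intro φ₀
    let ext : MvPolynomial ι ℂ →ₗ[ℂ] leftIdeal e :=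
      { toFun := fun f => ⟨R.tau f * e, mem_leftIdeal.2 ⟨_, rfl⟩⟩
        map_add' := fun f g => Subtype.ext <|
          (congrArg (· * e) (map_add R.tau f g)).trans (add_mul _ _ e)
        map_smul' := fun r f => Subtype.ext <|
          (congrArg (· * e) (map_smul R.tau r f)).trans (smul_mul_assoc r _ e) }
    let φ : MvPolynomial ι ℂ →ₗ[ℂ] MvPolynomial ι ℂ :=
      { toFun := fun f => R.act (φ₀ (ext f) : A) 1
        map_add' := fun f g => by
          rw [map_add, map_add, Submodule.coe_add, map_add, LinearMap.add_apply]
        map_smul' := fun r f => by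
          have h : φ₀ (r • ext f) = r • φ₀ (ext f) := LinearMap.map_smul_of_tower φ₀ r (ext f)
          rw [map_smul, h]
          exact congrArg (fun P : Module.End ℂ (MvPolynomial ι ℂ) => P 1)
            (map_smul R.act r (φ₀ (ext f) : A)) }
    have hext : ∀ x : leftIdeal e, ext (R.act x 1) = x := fun x => Subtype.ext (htau x).symm
    have hact : ∀ f, R.act (ext f : A) 1 = f := by
      intro f
      change R.act (R.tau f * e) 1 = f
      rw [map_mul, Module.End.mul_apply, hact1, R.act_tau_one halt]
    have hφ₀ : ∀ f, φ₀ (ext f) = ext (φ f) := fun f => (hext _).symm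
    have hφ : IsCornerLinear R φ := by
      intro u hu f
      have heu : R.act e u = u := by
        rw [hee]
        exact R.act_groupIdem hu
      let y : he.Corner := ⟨e * R.tau u * e, R.tau u, rfl⟩
      have hy : ∀ f, MulOpposite.op y • ext f = ext (R.act (R.tau f) u) := by
        intro f
        rw [← hext (MulOpposite.op y • ext f)]
        refine congrArg ext ?_
        rw [corner_smul_coe]
        change R.act (R.tau f * e * (e * R.tau u * e)) 1 = _
        simp only [map_mul, Module.End.mul_apply, hact1, R.act_tau_one halt, heu]
      change R.act (φ₀ (ext (R.act (R.tau f) u)) : A) 1 = _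
      rw [← hy, map_smul, hφ₀, hy, hact]
    obtain ⟨a, ha⟩ := hφ.exists_eq_act halt hG
    refine ⟨a, LinearMap.ext fun x => ?_⟩
    rw [← hext x, hφ₀, ha, ← hext (ηhom a _)]
    refine congrArg ext ?_
    change R.act (a * (R.tau (R.act x 1) * e)) 1 = _
    simp only [map_mul, Module.End.mul_apply, hact1, R.act_tau_one halt]
  exact ⟨AlgEquiv.ofBijective ηhom ⟨hinj, hsurj⟩, fun a x => rfl⟩

end PolynomialRep

end EndomorphismTheorem

/-! ### Generation by bireflections, the parameter `κ` and the algebra `A_{t,c}` -/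

section NoReflectionsOfGenerated

variable {V : Type*} [AddCommGroup V] [Module ℂ V] [FiniteDimensional ℂ V]
  {G : Subgroup (V ≃ₗ[ℂ] V)}

theorem det_eq_one_of_mem_bireflections {s : G} (hs : s ∈ bireflections G) :
    LinearMap.det ((s : V ≃ₗ[ℂ] V) : V →ₗ[ℂ] V) = 1 := by
  have h := hs.2 s (Commute.refl _)
  rw [quotDet] at h
  rw [LinearMap.det_eq_det_mul_det (fixedSpace (s : V ≃ₗ[ℂ] V)) _
    (fixedSpace_le_comap (Commute.refl _)), h, mul_one]
  convert LinearMap.det_id (A := ℂ) (M := fixedSpace (s : V ≃ₗ[ℂ] V))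
  refine LinearMap.ext fun v => Subtype.ext ?_
  exact mem_fixedSpace.1 v.2

theorem det_eq_one (hG : Subgroup.closure (bireflections G) = ⊤) (g : G) :
    LinearMap.det ((g : V ≃ₗ[ℂ] V) : V →ₗ[ℂ] V) = 1 := by
  have h : Subgroup.closure (bireflections G) ≤
      (LinearEquiv.det.comp G.subtype).ker := by
    rw [Subgroup.closure_le]
    intro s hs
    refine Units.ext ?_
    exact (LinearEquiv.coe_det (s : V ≃ₗ[ℂ] V)).trans (det_eq_one_of_mem_bireflections hs)
  rw [hG] at h
  have := congrArg Units.val (MonoidHom.mem_ker.1 (h (Subgroup.mem_top g)))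
  exact (LinearEquiv.coe_det (g : V ≃ₗ[ℂ] V)).symm.trans this

/-- A finite subgroup of `SL(V)` contains no reflections: an element `g = 1 + f ⊗ u` of determinant
one has `f(u) = 0`, so `g ^ k = 1 + k f ⊗ u`. -/
theorem noReflections [Fintype G] (hG : Subgroup.closure (bireflections G) = ⊤) :
    NoReflections G := by
  intro g hg
  by_contra! h
  obtain ⟨v, hv⟩ : ∃ v, (g : V ≃ₗ[ℂ] V) v - v ≠ 0 := by
    by_contra! h0
    exact hg (Subtype.ext (LinearEquiv.ext fun v => sub_eq_zero.1 (h0 v)))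
  set u := (g : V ≃ₗ[ℂ] V) v - v with hu
  obtain ⟨φ, hφ⟩ : ∃ φ : Module.Dual ℂ V, φ u = 1 :=
    Module.Projective.exists_dual_eq_one ℂ hv
  have hrange : ∀ w, (g : V ≃ₗ[ℂ] V) w - w = φ ((g : V ≃ₗ[ℂ] V) w - w) • u := by
    intro w
    have h1 := h v w
    rw [← hu, LinearIndependent.pair_iff' hv] at h1
    push Not at h1
    obtain ⟨a, ha⟩ := h1
    rw [← ha, map_smul, hφ, smul_eq_mul, mul_one]
  let f : Module.Dual ℂ V := φ ∘ₗ (((g : V ≃ₗ[ℂ] V) : V →ₗ[ℂ] V) - LinearMap.id)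
  have hgf : ((g : V ≃ₗ[ℂ] V) : V →ₗ[ℂ] V) = LinearMap.transvection f u := by
    refine LinearMap.ext fun w => ?_
    rw [LinearMap.transvection.apply]
    exact eq_add_of_sub_eq' (hrange w)
  have hdet := det_eq_one hG g
  rw [hgf, LinearMap.transvection.det] at hdet
  have hfu : (g : V ≃ₗ[ℂ] V) u = u := by
    have h0 : φ ((g : V ≃ₗ[ℂ] V) u - u) = 0 := left_eq_add.1 hdet.symm
    have := hrange u
    rwa [h0, zero_smul, sub_eq_zero] at this
  have hpow : ∀ k : ℕ, ((g ^ k : G) : V ≃ₗ[ℂ] V) v = v + (k : ℂ) • u := by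
    intro k
    induction k with
    | zero => simp
    | succ k ih =>
      rw [pow_succ']
      change (g : V ≃ₗ[ℂ] V) (((g ^ k : G) : V ≃ₗ[ℂ] V) v) = _
      rw [ih, map_add, map_smul, hfu, eq_add_of_sub_eq' hu.symm]
      push_cast
      module
  have hcard := hpow (Fintype.card G)
  rw [pow_card_eq_one] at hcard
  have h0 : (Fintype.card G : ℂ) • u = 0 := by simpa using hcard
  exact hv ((smul_eq_zero_iff_right (Nat.cast_ne_zero.2 Fintype.card_ne_zero)).1 h0)

end NoReflectionsOfGenerated

section Conjugation

variable {V : Type*} [AddCommGroup V] [Module ℂ V] {G : Subgroup (V ≃ₗ[ℂ] V)}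

theorem map_fixedSpace_conj (g s : V ≃ₗ[ℂ] V) :
    (fixedSpace (g⁻¹ * s * g)).map (g : V →ₗ[ℂ] V) = fixedSpace s := by
  ext v
  constructor
  · rintro ⟨w, hw, rfl⟩
    have h := mem_fixedSpace.1 hw
    refine mem_fixedSpace.2 ?_
    have h2 := congrArg g h
    have : g ((g⁻¹ * s * g) w) = (g * (g⁻¹ * s * g)) w := rfl
    rw [this, show g * (g⁻¹ * s * g) = s * g by group] at h2
    exact h2
  · intro hv
    refine ⟨g⁻¹ v, mem_fixedSpace.2 ?_, ?_⟩
    · have : (g⁻¹ * s * g) (g⁻¹ v) = g⁻¹ (s ((g * g⁻¹) v)) := rfl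
      rw [this, mul_inv_cancel]
      exact congrArg _ (mem_fixedSpace.1 hv)
    · change (g * g⁻¹) v = v
      rw [mul_inv_cancel]
      rfl

theorem conj_mem_bireflections {s : G} (hs : s ∈ bireflections G) (g : G) :
    g⁻¹ * s * g ∈ bireflections G := by
  obtain ⟨⟨hs1, hs2⟩, hdet⟩ := hs
  refine ⟨⟨fun h => hs1 ?_, ?_⟩, fun h hcomm => ?_⟩
  · have : (s : V ≃ₗ[ℂ] V) = g * (((g⁻¹ * s * g : G) : V ≃ₗ[ℂ] V)) * (g : V ≃ₗ[ℂ] V)⁻¹ := by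
      push_cast
      group
    rw [this, h]
    group
  · rw [← hs2]
    have h1 : LinearMap.id - (((g⁻¹ * s * g : G) : V ≃ₗ[ℂ] V)).toLinearMap =
        ((g : V ≃ₗ[ℂ] V)⁻¹ : V ≃ₗ[ℂ] V).toLinearMap ∘ₗ
          (LinearMap.id - (s : V ≃ₗ[ℂ] V).toLinearMap) ∘ₗ (g : V ≃ₗ[ℂ] V).toLinearMap := by
      refine LinearMap.ext fun v => ?_
      change v - _ = (g : V ≃ₗ[ℂ] V)⁻¹ ((g : V ≃ₗ[ℂ] V) v - _)
      rw [map_sub]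
      congr 1
      change v = ((g : V ≃ₗ[ℂ] V)⁻¹ * (g : V ≃ₗ[ℂ] V)) v
      rw [inv_mul_cancel]
      rfl
    rw [h1, LinearMap.range_comp, LinearMap.range_comp_of_range_eq_top _ (LinearEquiv.range _)]
    exact LinearEquiv.finrank_map_eq _ _
  · have hc' : Commute ((g * h * g⁻¹ : G) : V ≃ₗ[ℂ] V) (s : V ≃ₗ[ℂ] V) := by
      have : (s : V ≃ₗ[ℂ] V) = g * ((g⁻¹ * s * g : G) : V ≃ₗ[ℂ] V) * (g : V ≃ₗ[ℂ] V)⁻¹ := by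
        push_cast
        group
      rw [this]
      push_cast at hcomm ⊢
      exact (Commute.conj_iff _).2 hcomm
    rw [← hdet (g * h * g⁻¹) hc', quotDet, quotDet]
    let E : (V ⧸ fixedSpace ((g⁻¹ * s * g : G) : V ≃ₗ[ℂ] V)) ≃ₗ[ℂ]
        (V ⧸ fixedSpace (s : V ≃ₗ[ℂ] V)) :=
      Submodule.Quotient.equiv _ _ (g : V ≃ₗ[ℂ] V) (map_fixedSpace_conj (g : V ≃ₗ[ℂ] V) s)
    rw [← LinearMap.det_conj _ E]
    congr 1
    refine Submodule.linearMap_qext _ (LinearMap.ext fun v => ?_)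
    rfl

/-- Conjugation `s ↦ g⁻¹ s g` as a permutation of `𝒮'`. -/
def conjBireflections (g : G) : bireflections G ≃ bireflections G where
  toFun s := ⟨g⁻¹ * s * g, conj_mem_bireflections s.2 g⟩
  invFun s := ⟨g * s * g⁻¹, by simpa using conj_mem_bireflections s.2 g⁻¹⟩
  left_inv s := Subtype.ext (by simp [mul_assoc])
  right_inv s := Subtype.ext (by simp [mul_assoc])

end Conjugation

section Kappa

variable {V : Type*} [AddCommGroup V] [Module ℂ V] {G : Subgroup (V ≃ₗ[ℂ] V)}

/-- For an alternating form `Ω` whose radical `V^s` has codimension two, the alternating trilinear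
map `Ω(v, w)(s z - z) + …` factors through `⋀³(V / V^s) = 0`. -/
theorem FormSystem.jacobi [FiniteDimensional ℂ V] (F : FormSystem G) (s : bireflections G)
    (v w z : V) : F.form s v w • (((s : G) : V ≃ₗ[ℂ] V) z - z) +
      F.form s w z • (((s : G) : V ≃ₗ[ℂ] V) v - v) +
      F.form s z v • (((s : G) : V ≃ₗ[ℂ] V) w - w) = 0 := by
  have hneg : ∀ x y, F.form s y x = - F.form s x y := fun x y =>
    (LinearMap.IsAlt.neg (F.isAlt s) x y).symm
  have hself : ∀ x, F.form s x x = 0 := F.isAlt s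
  -- The values of the rank-two map `s - 1` on any three vectors are linearly dependent.
  obtain ⟨α, hα, i, hi⟩ : ∃ α : Fin 3 → ℂ,
      (∑ i, α i • (((s : G) : V ≃ₗ[ℂ] V) (![v, w, z] i) - ![v, w, z] i)) = 0 ∧
        ∃ i, α i ≠ 0 := by
    let T : V →ₗ[ℂ] V := LinearMap.id - ((s : G) : V ≃ₗ[ℂ] V).toLinearMap
    have hdep : ¬ LinearIndependent ℂ fun i : Fin 3 => T.rangeRestrict (![v, w, z] i) := by
      intro hli
      have h1 := hli.fintype_card_le_finrank
      have h2 : Module.finrank ℂ (LinearMap.range T) = 2 := s.2.1.2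
      rw [h2] at h1
      simp at h1
    obtain ⟨α, hα, hne⟩ := Fintype.not_linearIndependent_iff.1 hdep
    refine ⟨α, ?_, hne⟩
    rw [← neg_eq_zero, ← Finset.sum_neg_distrib]
    refine Eq.trans ?_ (congrArg (LinearMap.range T).subtype hα)
    rw [map_sum]
    refine Finset.sum_congr rfl fun i _ => ?_
    rw [← smul_neg, neg_sub]
    rfl
  have hmem : α 0 • v + α 1 • w + α 2 • z ∈ LinearMap.ker (F.form s) := by
    rw [F.radical s, mem_fixedSpace, ← sub_eq_zero, ← hα, Fin.sum_univ_three]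
    simp only [map_add, map_smul, Matrix.cons_val_zero, Matrix.cons_val_one, Matrix.cons_val]
    module
  simp only [Fin.sum_univ_three, Matrix.cons_val_zero, Matrix.cons_val_one, Matrix.cons_val] at hα
  rw [LinearMap.mem_ker] at hmem
  have e1 := LinearMap.congr_fun hmem v
  have e2 := LinearMap.congr_fun hmem w
  have e3 := LinearMap.congr_fun hmem z
  simp only [map_add, map_smul, LinearMap.add_apply, LinearMap.smul_apply, smul_eq_mul, hself,
    LinearMap.zero_apply, mul_zero, zero_add, add_zero, hneg v w, hneg w z, hneg z v] at e1 e2 e3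
  refine (smul_eq_zero_iff_right hi).1 ?_
  generalize F.form s v w = p at *
  generalize F.form s w z = q at *
  generalize F.form s z v = r at *
  generalize ((s : G) : V ≃ₗ[ℂ] V) v - v = dv at *
  generalize ((s : G) : V ≃ₗ[ℂ] V) w - w = dw at *
  generalize ((s : G) : V ≃ₗ[ℂ] V) z - z = dz at *
  have c1 : α 2 * r = α 1 * p := by linear_combination e1
  have c2 : α 0 * p = α 2 * q := by linear_combination e2
  have c3 : α 1 * q = α 0 * r := by linear_combination e3
  fin_cases i
  · calc α 0 • (p • dz + q • dv + r • dw)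
        = q • (α 0 • dv + α 1 • dw + α 2 • dz) + (α 0 * p - α 2 * q) • dz +
          (α 0 * r - α 1 * q) • dw := by module
      _ = 0 := by rw [hα, c2, c3]; simp
  · calc α 1 • (p • dz + q • dv + r • dw)
        = r • (α 0 • dv + α 1 • dw + α 2 • dz) + (α 1 * p - α 2 * r) • dz +
          (α 1 * q - α 0 * r) • dv := by module
      _ = 0 := by rw [hα, c1, c3]; simp
  · calc α 2 • (p • dz + q • dv + r • dw)
        = p • (α 0 • dv + α 1 • dw + α 2 • dz) + (α 2 * q - α 0 * p) • dv +
          (α 2 * r - α 1 * p) • dw := by module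
      _ = 0 := by rw [hα, c1, c2]; simp

variable [Fintype G] {N : ℕ} (b : Module.Basis (Fin N) ℂ (invariantForms G)) (F : FormSystem G)
  (t : Fin N → ℂ) (c : bireflections G → ℂ)

open scoped Classical in
/-- The parameter `κ` as a bilinear map. -/
def kappaBilin : V →ₗ[ℂ] V →ₗ[ℂ] MonoidAlgebra ℂ G :=
  LinearMap.mk₂ ℂ (kappa b F t c)
    (fun v v' w => by
      simp only [kappa, map_add, LinearMap.add_apply, mul_add, Finset.sum_add_distrib,
        MonoidAlgebra.single_add]
      abel)
    (fun r v w => by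
      simp only [kappa, map_smul, LinearMap.smul_apply, smul_eq_mul, smul_add, Finset.smul_sum,
        MonoidAlgebra.smul_single, Finset.mul_sum, mul_left_comm])
    (fun v w w' => by
      simp only [kappa, map_add, mul_add, Finset.sum_add_distrib, MonoidAlgebra.single_add]
      abel)
    (fun r v w => by
      simp only [kappa, map_smul, smul_eq_mul, smul_add, Finset.smul_sum,
        MonoidAlgebra.smul_single, Finset.mul_sum, mul_left_comm])

theorem kappaBilin_apply (v w : V) : kappaBilin b F t c v w = kappa b F t c v w := rfl

theorem kappaBilin_isSkew : IsSkew (kappaBilin b F t c) := by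
  intro v w
  have h1 : ∀ i, (b i : LinearMap.BilinForm ℂ V) v w = -(b i : LinearMap.BilinForm ℂ V) w v :=
    fun i => (LinearMap.IsAlt.neg (b i).2.1 w v).symm
  have h2 : ∀ s, F.form s v w = - F.form s w v :=
    fun s => (LinearMap.IsAlt.neg (F.isAlt s) w v).symm
  simp only [kappaBilin_apply, kappa, h1, h2, mul_neg, Finset.sum_neg_distrib,
    MonoidAlgebra.single_neg, neg_add]

theorem kappaBilin_isEquivariant
    (hc : ∀ s s' : bireflections G, IsConj (s : G) (s' : G) → c s = c s') :
    IsEquivariant (kappaBilin b F t c) := by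
  intro g v w
  classical
  have hb : ∀ i, (b i : LinearMap.BilinForm ℂ V) ((g : V ≃ₗ[ℂ] V) v) ((g : V ≃ₗ[ℂ] V) w) =
      (b i : LinearMap.BilinForm ℂ V) v w := fun i => (b i).2.2 g v w
  simp only [kappaBilin_apply, kappa, hb, add_mul, mul_add, Finset.sum_mul, Finset.mul_sum,
    MonoidAlgebra.of_apply, MonoidAlgebra.single_mul_single, one_mul, mul_one]
  congr 1
  refine Fintype.sum_equiv (conjBireflections g) _ _ fun s => ?_
  have hs : ((conjBireflections g s : bireflections G) : G) = g⁻¹ * s * g := rfl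
  rw [F.conj s (conjBireflections g s) g hs, hs,
    hc s (conjBireflections g s) (isConj_iff.2 ⟨g⁻¹, by rw [hs, inv_inv]⟩)]
  congr 1
  group

theorem kappaBilin_isJacobi [FiniteDimensional ℂ V] : IsJacobi (kappaBilin b F t c) := by
  intro g v w z
  classical
  have key : ∀ x y u : V, (kappaBilin b F t c x y).coeff g • ((g : V ≃ₗ[ℂ] V) u - u) =
      ∑ s : bireflections G, if (s : G) = g then
        c s • F.form s x y • (((s : G) : V ≃ₗ[ℂ] V) u - u) else 0 := by
    intro x y u
    rw [kappaBilin_apply, kappa, MonoidAlgebra.coeff_add, Finsupp.add_apply, add_smul]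
    have h1 : (MonoidAlgebra.single (1 : G)
        (∑ i, t i * (b i : LinearMap.BilinForm ℂ V) x y)).coeff g •
        ((g : V ≃ₗ[ℂ] V) u - u) = 0 := by
      by_cases hg : g = 1
      · simp [hg]
      · simp [MonoidAlgebra.coeff_single, Ne.symm hg]
    rw [h1, zero_add, MonoidAlgebra.coeff_sum, Finsupp.finsetSum_apply, Finset.sum_smul]
    refine Finset.sum_congr rfl fun s _ => ?_
    rw [MonoidAlgebra.coeff_single, Finsupp.single_apply]
    split_ifs with h
    · rw [h, mul_smul]
    · rw [zero_smul]
  rw [key, key, key, ← Finset.sum_add_distrib, ← Finset.sum_add_distrib]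
  refine Finset.sum_eq_zero fun s _ => ?_
  split_ifs
  · rw [← smul_add, ← smul_add, F.jacobi, smul_zero]
  · simp

end Kappa

section Representation

variable {V : Type*} [AddCommGroup V] [Module ℂ V] {G : Subgroup (V ≃ₗ[ℂ] V)} [Fintype G]
  {ι : Type*} [Fintype ι] (B : Module.Basis ι ℂ V)
  (κ : V →ₗ[ℂ] V →ₗ[ℂ] MonoidAlgebra ℂ G)

theorem groupAlgebraIncl_single (g : G) (r : ℂ) :
    groupAlgebraIncl G (MonoidAlgebra.single g r) =
      SkewMonoidAlgebra.single g (algebraMap ℂ (TensorAlgebra ℂ V) r) := by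
  rw [groupAlgebraIncl, MonoidAlgebra.lift_single, SkewMonoidAlgebra.of_apply,
    SkewMonoidAlgebra.smul_single, Algebra.algebraMap_eq_smul_one]

/-- The inclusion `V → T(V) ∗ G` as a linear map. -/
def vecLin (G : Subgroup (V ≃ₗ[ℂ] V)) : V →ₗ[ℂ] SkewTensor G where
  toFun := vec G
  map_add' v w := by simp [vec, SkewMonoidAlgebra.single_add]
  map_smul' r v := by simp [vec, SkewMonoidAlgebra.smul_single]

theorem of_mul_vec (g : G) (v : V) :
    groupAlgebraIncl G (MonoidAlgebra.of ℂ G g) * vec G v =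
      vec G ((g : V ≃ₗ[ℂ] V) v) * groupAlgebraIncl G (MonoidAlgebra.of ℂ G g) := by
  rw [MonoidAlgebra.of_apply, groupAlgebraIncl_single, vec, vec,
    SkewMonoidAlgebra.single_mul_single, SkewMonoidAlgebra.single_mul_single, smul_def,
    tensorMap_ι]
  simp

/-- The action of `T(V) ∗ G` on polynomials extending `v ↦ X_v` and the natural action of `G`. -/
def skewAct (hequiv : IsEquivariant κ) :
    SkewTensor G →ₐ[ℂ] Module.End ℂ (MvPolynomial ι ℂ) :=
  SkewMonoidAlgebra.liftNCAlgHom (TensorAlgebra.lift ℂ (vecOp B κ))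
    ((groupAct B G : MonoidAlgebra ℂ G →* Module.End ℂ (MvPolynomial ι ℂ)).comp
      (MonoidAlgebra.of ℂ G)) (by
    intro x g
    change TensorAlgebra.lift ℂ (vecOp B κ) (g • x) * groupAct B G (MonoidAlgebra.of ℂ G g) =
      groupAct B G (MonoidAlgebra.of ℂ G g) * TensorAlgebra.lift ℂ (vecOp B κ) x
    rw [smul_def]
    induction x using TensorAlgebra.induction with
    | algebraMap r => simp only [AlgHom.commutes, Algebra.commutes]
    | ι v =>
      rw [tensorMap_ι, TensorAlgebra.lift_ι_apply, TensorAlgebra.lift_ι_apply]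
      refine LinearMap.ext fun f => ?_
      simp [Module.End.mul_apply, polyAct_vecOp B κ hequiv]
    | mul x y hx hy => rw [map_mul, map_mul, map_mul, mul_assoc, hy, ← mul_assoc, hx, mul_assoc]
    | add x y hx hy => rw [map_add, map_add, map_add, add_mul, mul_add, hx, hy])

theorem skewAct_single (hequiv : IsEquivariant κ) (g : G) (x : TensorAlgebra ℂ V) :
    skewAct B κ hequiv (SkewMonoidAlgebra.single g x) =
      TensorAlgebra.lift ℂ (vecOp B κ) x * groupAct B G (MonoidAlgebra.of ℂ G g) :=
  SkewMonoidAlgebra.liftNC_single _ _ _ _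

theorem skewAct_vec (hequiv : IsEquivariant κ) (v : V) :
    skewAct B κ hequiv (vec G v) = vecOp B κ v := by
  rw [vec, skewAct_single, map_one, map_one, mul_one, TensorAlgebra.lift_ι_apply]

theorem skewAct_groupAlgebraIncl
    (hequiv : IsEquivariant κ) (x : MonoidAlgebra ℂ G) :
    skewAct B κ hequiv (groupAlgebraIncl G x) = groupAct B G x := by
  induction x using MonoidAlgebra.induction_linear with
  | zero => simp only [map_zero]
  | add x y hx hy => simp only [map_add, hx, hy]
  | single g r =>
    have : MonoidAlgebra.single g r = r • MonoidAlgebra.of ℂ G g := by simp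
    rw [groupAlgebraIncl_single, skewAct_single, AlgHom.commutes, ← Algebra.smul_def, this,
      map_smul]

/-- The polynomial representation of the factor algebra `(T(V) ∗ G) / ⟨[v, w] - κ(v, w)⟩`. -/
def quotRep (halt : IsSkew κ)
    (hequiv : IsEquivariant κ)
    (hjac : IsJacobi κ) :
    PolynomialRep B κ (Quot G fun v w => κ v w) where
  vec := (quotMk G fun v w => κ v w).toLinearMap ∘ₗ vecLin G
  grp := (quotMk G fun v w => κ v w).comp (groupAlgebraIncl G)
  act := RingQuot.liftAlgHom ℂ ⟨skewAct B κ hequiv, by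
    rintro _ _ ⟨v, w⟩
    rw [map_sub, map_mul, map_mul, skewAct_vec, skewAct_vec, skewAct_groupAlgebraIncl]
    refine sub_eq_zero.1 (LinearMap.ext fun f => ?_)
    exact defect_eq_zero B κ halt hequiv hjac (f.totalDegree + 1) f
      (by push_cast; exact exists_mem_degLT f) v w⟩
  grp_mul_vec g v := by
    have := congrArg (quotMk G fun v w => κ v w) (of_mul_vec g v)
    rwa [map_mul, map_mul] at this
  vec_mul_vec v w := by
    have := RingQuot.mkAlgHom_rel ℂ (Rel.comm (G := G) (κ := fun v w => κ v w) v w)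
    rw [map_sub, map_mul, map_mul] at this
    exact this
  act_vec v := (RingQuot.liftAlgHom_mkAlgHom_apply ℂ _ _ _).trans (skewAct_vec B κ hequiv v)
  act_grp x := (RingQuot.liftAlgHom_mkAlgHom_apply ℂ _ _ _).trans
    (skewAct_groupAlgebraIncl B κ hequiv x)
  eq_top W h1 hv hg := by
    rw [eq_top_iff]
    rintro a -
    obtain ⟨x, rfl⟩ := RingQuot.mkAlgHom_surjective ℂ (Rel G fun v w => κ v w) a
    have key : ∀ (x : SkewTensor G), ∀ a ∈ W, quotMk G (fun v w => κ v w) x * a ∈ W := by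
      have hT : ∀ (y : TensorAlgebra ℂ V), ∀ a ∈ W,
          quotMk G (fun v w => κ v w) (SkewMonoidAlgebra.single 1 y) * a ∈ W := by
        intro y
        induction y using TensorAlgebra.induction with
        | algebraMap r =>
          intro a ha
          have h : SkewMonoidAlgebra.single (1 : G) (algebraMap ℂ (TensorAlgebra ℂ V) r) =
              algebraMap ℂ (SkewTensor G) r := rfl
          rw [h, AlgHom.commutes, ← Algebra.smul_def]
          exact W.smul_mem r ha
        | ι v => exact hv v
        | mul y z hy hz =>
          intro a ha
          have h : SkewMonoidAlgebra.single (1 : G) (y * z) =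
              SkewMonoidAlgebra.single 1 y * SkewMonoidAlgebra.single 1 z := by
            rw [SkewMonoidAlgebra.single_mul_single, mul_one, one_smul]
          rw [h, map_mul, mul_assoc]
          exact hy _ (hz a ha)
        | add y z hy hz =>
          intro a ha
          rw [SkewMonoidAlgebra.single_add, map_add, add_mul]
          exact W.add_mem (hy a ha) (hz a ha)
      intro x
      induction x using SkewMonoidAlgebra.induction_on with
      | zero =>
        intro a _
        rw [map_zero, zero_mul]
        exact W.zero_mem
      | single g y =>
        intro a ha
        have h : SkewMonoidAlgebra.single g y = SkewMonoidAlgebra.single 1 y *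
            groupAlgebraIncl G (MonoidAlgebra.of ℂ G g) := by
          rw [MonoidAlgebra.of_apply, groupAlgebraIncl_single, map_one,
            SkewMonoidAlgebra.single_mul_single, one_mul, one_smul, mul_one]
        rw [h, map_mul, mul_assoc]
        exact hT y _ (hg _ a ha)
      | add x y hx hy =>
        intro a ha
        rw [map_add, add_mul]
        exact W.add_mem (hx a ha) (hy a ha)
    have := key x 1 h1
    rwa [mul_one] at this

end Representation

end GradedHecke

end

theorem mainTheorem5 {V : Type*} [AddCommGroup V] [Module ℂ V] [FiniteDimensional ℂ V]
    (G : Subgroup (V ≃ₗ[ℂ] V)) [Fintype G]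
    (hG : Subgroup.closure (GradedHecke.bireflections G) = ⊤)
    {N : ℕ} (b : Module.Basis (Fin N) ℂ (GradedHecke.invariantForms G))
    (F : GradedHecke.FormSystem G)
    (t : Fin N → ℂ) (c : GradedHecke.bireflections G → ℂ)
    (hc : ∀ s s' : GradedHecke.bireflections G, IsConj (s : G) (s' : G) → c s = c s') :
    ∃ η : GradedHecke.Alg b F t c ≃ₐ[ℂ]
        Module.End
          (GradedHecke.idem_isIdempotentElem G (GradedHecke.kappa b F t c)).Cornerᵐᵒᵖ
          (GradedHecke.leftIdeal (GradedHecke.idem G (GradedHecke.kappa b F t c))),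
      ∀ (a : GradedHecke.Alg b F t c)
        (x : GradedHecke.leftIdeal (GradedHecke.idem G (GradedHecke.kappa b F t c))),
        (η a x : GradedHecke.Alg b F t c) = a * x :=
  (GradedHecke.quotRep (Module.finBasis ℂ V) (GradedHecke.kappaBilin b F t c)
    (GradedHecke.kappaBilin_isSkew b F t c) (GradedHecke.kappaBilin_isEquivariant b F t c hc)
    (GradedHecke.kappaBilin_isJacobi b F t c)).exists_algEquiv_end
    (GradedHecke.kappaBilin_isSkew b F t c) (GradedHecke.noReflections hG)
    (GradedHecke.idem_isIdempotentElem G (GradedHecke.kappa b F t c)) rfl
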